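/- Let $n\ge 1$, and let $\mathrm{ASM}(n)$ be the set of all $n\times n$ alternating sign matrices, i.e. matrices with entries in $\{0,1,-1\}$ such that in each row and each column the nonzero entries alternate between $1$ and $-1$, beginning and ending with $1$. For $A\in\mathrm{ASM}(n)$ let $\mu(A)$ be the number of entries $-1$ in $A$, let $f(A)\in\{1,\dots,n\}$ be the column index of the unique $1$ in the first row of $A$, and let $\ell(A)\in\{1,\dots,n\}$ be the column index of the unique $1$ in the last row of $A$. Put $$A_n(z,\rho,\tau)=\sum_{A\in \mathrm{ASM}(n)} z^{\mu(A)}\rho^{f(A)}\tau^{\ell(A)}.$$ Let $q,\rho$ be elements of a field of characteristic $0$ (for example complex numbers, or the two indeterminates in $\mathbb{Q}(q,\rho)$) with $q\notin\{0,1,-1\}$ and $1+\rho q\ne 0$. Then $$A_n(2+q+q^{-1},\rho,1)=\sum_{A\in \mathrm{ASM}(n)}(2+q+q^{-1})^{\mu(A)}\rho^{f(A)}=\frac{\rho\cdot\det\bigl(K^{\rho,1}_{i,j}(q)\bigr)_{1\le i,j\le n}}{(1+\rho q)(1+q)^{n-1}(2-q-q^{-1})^{\frac{n(n-1)}{2}}},$$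 where $$K^{\rho,1}_{i,j}(q)=\sum_{k=-n+1}^{n}(-1)^{k+1}\,\frac{q^k-q^{-k}}{q-q^{-1}}\binom{2j+k-3}{i-1}\left[(1+\rho q)\binom{n-1}{j+k-2}+(\rho+q)\binom{n-1}{j+k-1}\right].$$ Here, for integers $a,b$, $\binom{a}{b}=a(a-1)\cdots(a-b+1)/b!$ if $b\ge 0$ and $\binom{a}{b}=0$ if $b<0$. -/

import Mathlib

/-- The finite sequence `v` has all entries in `{0, 1, -1}`, and its nonzero entries alternate
between `1` and `-1`, beginning and ending with `1`. -/
structure IsAlternating {n : ℕ} (v : Fin n → ℤ) : Prop where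
  /-- the entries are `0`, `1` or `-1` -/
  entry : ∀ i, v i = 0 ∨ v i = 1 ∨ v i = -1
  /-- the first nonzero entry exists and is `1` -/
  first : ∃ i, v i = 1 ∧ ∀ j, j < i → v j = 0
  /-- the last nonzero entry exists and is `1` -/
  last : ∃ i, v i = 1 ∧ ∀ j, i < j → v j = 0
  /-- consecutive nonzero entries have opposite signs -/
  alternate : ∀ i j, i < j → v i ≠ 0 → v j ≠ 0 → (∀ k, i < k → k < j → v k = 0) → v j = -v i

/-- Alternating sign matrices: every row and every column is alternating. -/
structure IsASM {n : ℕ} (A : Matrix (Fin n) (Fin n) ℤ) : Prop where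
  row : ∀ i, IsAlternating (fun j => A i j)
  col : ∀ j, IsAlternating (fun i => A i j)

/-- The set `ASM(n)` of all `n × n` alternating sign matrices. -/
def ASM (n : ℕ) : Type := {A : Matrix (Fin n) (Fin n) ℤ // IsASM A}

instance ASM.instFinite (n : ℕ) : Finite (ASM n) := by
  have hfin : ({0, 1, -1} : Set ℤ).Finite := by simp
  have h : (Set.pi Set.univ (fun _ : Fin n =>
      Set.pi Set.univ (fun _ : Fin n => ({0, 1, -1} : Set ℤ)))).Finite :=
    Set.Finite.pi' (fun _ => Set.Finite.pi' (fun _ => hfin)) |>.subset (by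
      intro A hA i j
      exact hA i (Set.mem_univ _) j (Set.mem_univ _))
  have h2 : {A : Matrix (Fin n) (Fin n) ℤ | IsASM A}.Finite := by
    refine h.subset ?_
    intro A hA i _ j _
    exact (hA.row i).entry j
  exact h2.to_subtype

noncomputable instance ASM.instFintype (n : ℕ) : Fintype (ASM n) := Fintype.ofFinite _

/-- An alternating sequence without entries `-1` contains a single `1`. -/
theorem IsAlternating.existsUnique_one {n : ℕ} {v : Fin n → ℤ} (hv : IsAlternating v)
    (h : ∀ j, v j ≠ -1) : ∃! j, v j = 1 := by
  obtain ⟨i, hi, hlt⟩ := hv.first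
  refine ⟨i, hi, ?_⟩
  have key : ∀ m : ℕ, ∀ j : Fin n, (j : ℕ) = m → i < j → v j = 0 := by
    intro m
    induction m using Nat.strong_induction_on with
    | _ m ih =>
      intro j hj hij
      by_contra hne
      refine h j ?_
      have := hv.alternate i j hij (by omega) hne
        (fun k hk hkj => ih k (by rw [← hj]; exact hkj) k rfl hk)
      rw [this, hi]
  intro j hj
  have hj : v j = 1 := hj
  rcases lt_trichotomy j i with hji | hji | hji
  · have := hlt j hji
    omega
  · exact hji
  · have := key j j rfl hji
    omega

/-- The first row of an alternating sign matrix contains a unique `1`. -/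
theorem ASM.existsUnique_first {n : ℕ} [NeZero n] (A : ASM n) :
    ∃! j : Fin n, A.1 0 j = 1 := by
  refine (A.2.row 0).existsUnique_one fun j hj => ?_
  obtain ⟨i, hi, hlt⟩ := (A.2.col j).first
  have hj : A.1 0 j = -1 := hj
  have hi : A.1 i j = 1 := hi
  rcases (Fin.zero_le i).eq_or_lt with h | h
  · rw [← h] at hi
    omega
  · have : A.1 0 j = 0 := hlt 0 h
    omega

/-- The last row of an alternating sign matrix contains a unique `1`
(`⊤ : Fin n` is the largest index). -/
theorem ASM.existsUnique_last {n : ℕ} [NeZero n] (A : ASM n) :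
    ∃! j : Fin n, A.1 ⊤ j = 1 := by
  refine (A.2.row ⊤).existsUnique_one fun j hj => ?_
  obtain ⟨i, hi, hlt⟩ := (A.2.col j).last
  have hj : A.1 ⊤ j = -1 := hj
  have hi : A.1 i j = 1 := hi
  rcases (le_top : i ≤ ⊤).eq_or_lt with h | h
  · rw [h] at hi
    omega
  · have : A.1 ⊤ j = 0 := hlt ⊤ h
    omega

/-- `μ(A)`: the number of entries `-1` in `A`. -/
def ASM.mu {n : ℕ} (A : ASM n) : ℕ :=
  (Finset.univ.filter (fun p : Fin n × Fin n => A.1 p.1 p.2 = -1)).card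

/-- `f(A)`: the column index, in `{1, …, n}`, of the unique `1` in the first row of `A`. -/
noncomputable def ASM.f {n : ℕ} [NeZero n] (A : ASM n) : ℕ :=
  (A.existsUnique_first.choose : ℕ) + 1

/-- `ℓ(A)`: the column index, in `{1, …, n}`, of the unique `1` in the last row of `A`. -/
noncomputable def ASM.ell {n : ℕ} [NeZero n] (A : ASM n) : ℕ :=
  (A.existsUnique_last.choose : ℕ) + 1

/-- The generating function `A_n(z, ρ, τ) = ∑_{A ∈ ASM(n)} z^{μ(A)} ρ^{f(A)} τ^{ℓ(A)}`. -/
noncomputable def asmGenFun {F : Type*} [Field F] (n : ℕ) [NeZero n] (z ρ τ : F) : F :=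
  ∑ A : ASM n, z ^ A.mu * ρ ^ A.f * τ ^ A.ell

/-- The binomial coefficient with integer arguments: `a (a - 1) ⋯ (a - b + 1) / b!` if `b ≥ 0`,
and `0` if `b < 0`. -/
def intBinom (a b : ℤ) : ℤ := if 0 ≤ b then Ring.choose a b.toNat else 0

/-- The entry `K^{ρ,1}_{i,j}(q)`, with indices `i, j` counted from `1`. -/
noncomputable def kEntry {F : Type*} [Field F] (n : ℕ) (q ρ : F) (i j : ℤ) : F :=
  ∑ k ∈ Finset.Icc (-(n : ℤ) + 1) (n : ℤ),
    (-1 : F) ^ (k + 1) * ((q ^ k - q ^ (-k)) / (q - q⁻¹)) * (intBinom (2 * j + k - 3) (i - 1) : F) *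
      ((1 + ρ * q) * (intBinom ((n : ℤ) - 1) (j + k - 2) : F)
        + (ρ + q) * (intBinom ((n : ℤ) - 1) (j + k - 1) : F))

/-- The matrix `(K^{ρ,1}_{i,j}(q))_{1 ≤ i, j ≤ n}`. -/
noncomputable def kMatrix {F : Type*} [Field F] (n : ℕ) (q ρ : F) : Matrix (Fin n) (Fin n) F :=
  Matrix.of fun i j => kEntry n q ρ ((i : ℕ) + 1 : ℤ) ((j : ℕ) + 1 : ℤ)

/-! Both sides are computed from one object, the six-vertex partition function with domain wall
boundary.

Partial row and column sums identify alternating sign matrices with the configurations obeying the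
ice rule (`partitionFunction_eq_sum_ASM`). With all parameters equal to 1, an entry `a` has weight
(1 - q)(1 + q)^a, times 2 + q + q⁻¹ if `a = -1`; each row sums to 1, so the powers of 1 + q depend
only on the size and z^μ survives. In the first row the parameter (ρ + q)/(1 + ρq) gives a zero to
the left of the 1 exactly ρ times the weight of a zero to its right, which produces ρ^(f - 1)
(`partitionFunction_eq_sum_weight`).

On the other hand the partition function is a determinant. By Yang-Baxter it is symmetric in the
column parameters; in the first row parameter it is a polynomial of degree below the size, and at q
times a column parameter it reduces to a smaller size. Kostov's determinant divided by a Vandermonde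
determinant has the same properties, so interpolation identifies the two
(`partitionFunction_mul_det_vandermonde`). When all column parameters become 1, divided differences
turn into Taylor coefficients at 1 (`partitionFunction_replicate_one`). The Taylor coefficients of
monomials are binomial coefficients, and the expanded columns of Kostov's matrix are those of
`kMatrix` up to scalars (`partitionFunction_eq_det_kMatrix`). -/

/-! ### The six-vertex model: Yang-Baxter, symmetry in the columns, recursion in the first row. -/

section SixVertex

open Matrix Kronecker

variable {R : Type*} [CommRing R]

/-- The six-vertex weight with row parameter `w`, column parameter `y`, horizontal edges `h, h'`
and vertical edges `v, v'`, as a matrix indexed by the vertical edges. The parameter `u` stands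
for `q⁻¹`. -/
def vertexMatrix (q u w y : R) (h h' : Bool) : Matrix Bool Bool R :=
  Matrix.of fun v v' => match h, v, h', v' with
    | false, false, false, false => w - q * y
    | true, true, true, true => w - q * y
    | false, true, false, true => y - q * w
    | true, false, true, false => y - q * w
    | false, false, true, true => (1 - q ^ 2) * y
    | true, true, false, false => (u - q) * w
    | _, _, _, _ => 0

/-- The partition function of a single column, as a matrix indexed by its outer vertical edges,
for given horizontal edges `l`, `r` on its left and right. -/
def monodromy (q u : R) : (m : ℕ) → (Fin m → R) → R → (Fin m → Bool) → (Fin m → Bool) →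
    Matrix Bool Bool R
  | 0, _, _, _, _ => 1
  | m + 1, w, y, l, r =>
    vertexMatrix q u (w 0) y (l 0) (r 0) * monodromy q u m (Fin.tail w) y (Fin.tail l) (Fin.tail r)

/-- The column transfer matrix with domain wall boundary conditions at top and bottom. -/
def columnTransfer (q u : R) {m : ℕ} (w : Fin m → R) (y : R) :
    Matrix (Fin m → Bool) (Fin m → Bool) R :=
  Matrix.of fun l r => monodromy q u m w y l r false true

/-- The product of the column transfer matrices for a list of column parameters. -/
def transferProd (q u : R) {m : ℕ} (w : Fin m → R) (ys : List R) :
    Matrix (Fin m → Bool) (Fin m → Bool) R :=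
  (ys.map (columnTransfer q u w)).prod

/-- The partition function with domain wall boundary conditions. -/
def partitionFunction (q u : R) {m : ℕ} (w : Fin m → R) (ys : List R) : R :=
  transferProd q u w ys (fun _ => false) (fun _ => true)

/-- The intertwiner of two columns. -/
def intertwiner (q y₁ y₂ : R) : Matrix (Bool × Bool) (Bool × Bool) R :=
  Matrix.of fun v v' => match v, v' with
    | (false, false), (false, false) => y₂ - q ^ 2 * y₁
    | (true, true), (true, true) => y₂ - q ^ 2 * y₁
    | (false, true), (false, true) => (1 - q ^ 2) * y₁
    | (true, false), (true, false) => (1 - q ^ 2) * y₂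
    | (false, true), (true, false) => q * (y₁ - y₂)
    | (true, false), (false, true) => q * (y₁ - y₂)
    | _, _ => 0

/-- The Yang-Baxter equation. -/
theorem vertexMatrix_yangBaxter {q u : R} (hu : q * u = 1) (w y₁ y₂ : R) (l r : Bool) :
    (∑ m, vertexMatrix q u w y₁ l m ⊗ₖ vertexMatrix q u w y₂ m r) * intertwiner q y₁ y₂ =
      intertwiner q y₁ y₂ *
        ∑ m, vertexMatrix q u w y₂ l m ⊗ₖ vertexMatrix q u w y₁ m r := by
  ext ⟨a, b⟩ ⟨c, d⟩
  simp only [Matrix.mul_apply, Fintype.sum_prod_type, Fintype.sum_bool, Matrix.add_apply,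
    Matrix.kroneckerMap_apply]
  cases l <;> cases r <;> cases a <;> cases b <;> cases c <;> cases d <;>
    simp [vertexMatrix, intertwiner] <;> try ring1
  all_goals grind

/-- The partition function of two adjacent columns. -/
def doubleMonodromy (q u : R) (m : ℕ) (w : Fin m → R) (y₁ y₂ : R) (l r : Fin m → Bool) :
    Matrix (Bool × Bool) (Bool × Bool) R :=
  ∑ k, monodromy q u m w y₁ l k ⊗ₖ monodromy q u m w y₂ k r

theorem doubleMonodromy_succ (q u : R) (m : ℕ) (w : Fin (m + 1) → R) (y₁ y₂ : R)
    (l r : Fin (m + 1) → Bool) :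
    doubleMonodromy q u (m + 1) w y₁ y₂ l r =
      (∑ k, vertexMatrix q u (w 0) y₁ (l 0) k ⊗ₖ vertexMatrix q u (w 0) y₂ k (r 0)) *
        doubleMonodromy q u m (Fin.tail w) y₁ y₂ (Fin.tail l) (Fin.tail r) := by
  rw [doubleMonodromy, ← (Fin.consEquiv fun _ => Bool).sum_comp, Fintype.sum_prod_type,
    doubleMonodromy, Finset.sum_mul_sum]
  refine Finset.sum_congr rfl fun a _ => Finset.sum_congr rfl fun k _ => ?_
  simp [monodromy, Fin.consEquiv, Matrix.mul_kronecker_mul]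

/-- The intertwiner is carried through the rows one at a time, by Yang-Baxter at each row. -/
theorem doubleMonodromy_mul_intertwiner {q u : R} (hu : q * u = 1) (m : ℕ) (w : Fin m → R)
    (y₁ y₂ : R) (l r : Fin m → Bool) :
    doubleMonodromy q u m w y₁ y₂ l r * intertwiner q y₁ y₂ =
      intertwiner q y₁ y₂ * doubleMonodromy q u m w y₂ y₁ l r := by
  induction m with
  | zero => simp [doubleMonodromy, monodromy]
  | succ m ih =>
    rw [doubleMonodromy_succ, doubleMonodromy_succ, Matrix.mul_assoc, ih, ← Matrix.mul_assoc,
      vertexMatrix_yangBaxter hu, Matrix.mul_assoc]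

theorem columnTransfer_mul_apply (q u : R) {m : ℕ} (w : Fin m → R) (y₁ y₂ : R)
    (l r : Fin m → Bool) :
    (columnTransfer q u w y₁ * columnTransfer q u w y₂) l r =
      doubleMonodromy q u m w y₁ y₂ l r (false, false) (true, true) := by
  simp [Matrix.mul_apply, columnTransfer, doubleMonodromy, Matrix.sum_apply]

theorem columnTransfer_commute [IsDomain R] {q u : R} (hu : q * u = 1) {m : ℕ} (w : Fin m → R)
    {y₁ y₂ : R} (hy : y₂ ≠ q ^ 2 * y₁) :
    Commute (columnTransfer q u w y₁) (columnTransfer q u w y₂) := by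
  ext l r
  rw [columnTransfer_mul_apply, columnTransfer_mul_apply]
  -- On the pairs of equal edges the intertwiner is diagonal with the single eigenvalue `y₂ - q ^ 2
  -- * y₁`, which can be cancelled.
  have h := congrFun₂ (doubleMonodromy_mul_intertwiner hu m w y₁ y₂ l r) (false, false) (true, true)
  simp only [Matrix.mul_apply, Fintype.sum_prod_type, Fintype.sum_bool, intertwiner,
    Matrix.of_apply, mul_zero, zero_mul, add_zero, zero_add] at h
  refine mul_left_cancel₀ (sub_ne_zero.2 hy) ?_
  rw [← h, mul_comm]

theorem partitionFunction_perm [IsDomain R] {q u : R} (hu : q * u = 1) {m : ℕ} (w : Fin m → R)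
    {ys zs : List R} (hp : ys.Perm zs) (hy : ∀ a ∈ ys, ∀ b ∈ ys, b ≠ q ^ 2 * a) :
    partitionFunction q u w ys = partitionFunction q u w zs := by
  rw [partitionFunction, partitionFunction, transferProd, transferProd,
    (hp.map (columnTransfer q u w)).prod_eq']
  refine List.Pairwise.map _ (R := fun a b => a ∈ ys ∧ b ∈ ys) ?_ ?_
  · exact fun a b hab => columnTransfer_commute hu w (hy a hab.1 b hab.2)
  · exact List.pairwise_of_forall_mem_list fun a ha b hb => ⟨ha, hb⟩

/-- The edges above the first row are all `false`, so a first-row edge never returns from `true` to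
`false`: the row switches at most once, at its entry 1. -/
theorem columnTransfer_cons (q u : R) {m : ℕ} (x : R) (w : Fin m → R) (y : R) (a b : Bool)
    (l r : Fin m → Bool) :
    columnTransfer q u (Fin.cons x w : Fin (m + 1) → R) y (Fin.cons a l) (Fin.cons b r) =
      match a, b with
      | false, false => (x - q * y) * columnTransfer q u w y l r
      | false, true => (1 - q ^ 2) * y * monodromy q u m w y l r true true
      | true, false => 0
      | true, true => (y - q * x) * columnTransfer q u w y l r := by
  cases a <;> cases b <;>
    simp [columnTransfer, monodromy, Matrix.mul_apply, vertexMatrix]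

theorem transferProd_nil (q u : R) {m : ℕ} (w : Fin m → R) : transferProd q u w [] = 1 := rfl

theorem transferProd_cons (q u : R) {m : ℕ} (w : Fin m → R) (y : R) (ys : List R) :
    transferProd q u w (y :: ys) = columnTransfer q u w y * transferProd q u w ys := by
  simp [transferProd]

theorem transferProd_cons_cons (q u : R) {m : ℕ} (x : R) (w : Fin m → R) (y : R) (ys : List R)
    (a b : Bool) (l r : Fin m → Bool) :
    transferProd q u (Fin.cons x w : Fin (m + 1) → R) (y :: ys) (Fin.cons a l) (Fin.cons b r) =
      ∑ c, ∑ k, columnTransfer q u (Fin.cons x w : Fin (m + 1) → R) y (Fin.cons a l) (Fin.cons c k) *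
        transferProd q u (Fin.cons x w : Fin (m + 1) → R) ys (Fin.cons c k) (Fin.cons b r) := by
  rw [transferProd_cons, Matrix.mul_apply, ← (Fin.consEquiv fun _ => Bool).sum_comp,
    Fintype.sum_prod_type]
  rfl

theorem transferProd_true_true (q u : R) {m : ℕ} (x : R) (w : Fin m → R) (ys : List R)
    (l r : Fin m → Bool) :
    transferProd q u (Fin.cons x w : Fin (m + 1) → R) ys (Fin.cons true l) (Fin.cons true r) =
      (ys.map fun y => y - q * x).prod * transferProd q u w ys l r := by
  induction ys generalizing l with
  | nil => simp [transferProd_nil, Matrix.one_apply, Fin.cons_inj]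
  | cons y ys ih =>
    rw [transferProd_cons_cons, Fintype.sum_bool]
    simp only [columnTransfer_cons, ih, zero_mul, Finset.sum_const_zero, add_zero]
    rw [transferProd_cons, Matrix.mul_apply, Finset.mul_sum]
    refine Finset.sum_congr rfl fun k _ => ?_
    rw [List.map_cons, List.prod_cons]
    ring

theorem transferProd_false_true (q u : R) {m : ℕ} (x : R) (w : Fin m → R) (y : R) (ys : List R)
    (l r : Fin m → Bool) :
    transferProd q u (Fin.cons x w : Fin (m + 1) → R) (y :: ys) (Fin.cons false l)
        (Fin.cons true r) =
      (x - q * y) * ∑ k, columnTransfer q u w y l k *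
          transferProd q u (Fin.cons x w : Fin (m + 1) → R) ys (Fin.cons false k) (Fin.cons true r) +
        (1 - q ^ 2) * y * (ys.map fun z => z - q * x).prod *
          ∑ k, monodromy q u m w y l k true true * transferProd q u w ys k r := by
  rw [transferProd_cons_cons, Fintype.sum_bool, add_comm]
  simp only [columnTransfer_cons, transferProd_true_true, Finset.mul_sum]
  congr 1 <;> exact Finset.sum_congr rfl fun k _ => by ring

/-- A vertex with `false` on its left and `true` above admits one continuation, which keeps both, so
the whole column is forced. -/
theorem monodromy_true_true (q u : R) (m : ℕ) (w : Fin m → R) (y : R) (r : Fin m → Bool) :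
    monodromy q u m w y (fun _ => false) r true true =
      if r = fun _ => false then ∏ i, (y - q * w i) else 0 := by
  induction m with
  | zero => simp [monodromy, Subsingleton.elim r fun _ => false]
  | succ m ih =>
    have hr : (r = fun _ => false) ↔ r 0 = false ∧ Fin.tail r = fun _ => false := by
      refine ⟨fun h => by subst h; exact ⟨rfl, rfl⟩, fun h => ?_⟩
      rw [← Fin.cons_self_tail r, h.1, h.2]
      ext i
      refine Fin.cases rfl (fun i => rfl) i
    have ht : Fin.tail (fun _ : Fin (m + 1) => false) = fun _ => false := rfl
    rw [monodromy, Matrix.mul_apply, Fintype.sum_bool, ht, ih, Fin.prod_univ_succ]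
    cases h0 : r 0 <;> simp [hr, h0, vertexMatrix, Fin.tail]

/-- If the weight of the corner vanishes unless it carries an entry `1`, then the first row and
the first column are frozen. -/
theorem partitionFunction_frozen (q u : R) {m : ℕ} (w : Fin m → R) (y : R) (ys : List R) :
    partitionFunction q u (Fin.cons (q * y) w : Fin (m + 1) → R) (y :: ys) =
      (1 - q ^ 2) * y * (ys.map fun z => z - q * (q * y)).prod * (∏ i, (y - q * w i)) *
        partitionFunction q u w ys := by
  have h : ∀ b : Bool, (fun _ : Fin (m + 1) => b) = Fin.cons b fun _ => b := fun b => by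
    ext i
    refine Fin.cases rfl (fun i => rfl) i
  rw [partitionFunction, h, h, transferProd_false_true]
  simp [monodromy_true_true, partitionFunction, mul_assoc]

/-- Every first-row vertex is linear in `x` except the one where the row switches, which is
constant; this saves one degree. -/
theorem transferProd_polynomial (q u : R) {m : ℕ} (w : Fin m → R) (ys : List R)
    (l r : Fin m → Bool) :
    ∃ p : Polynomial R, p.degree < ys.length ∧ ∀ x, p.eval x =
      transferProd q u (Fin.cons x w : Fin (m + 1) → R) ys (Fin.cons false l) (Fin.cons true r) := by
  nontriviality R
  induction ys generalizing l with
  | nil =>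
    refine ⟨0, by simp, fun x => ?_⟩
    have : (Fin.cons false l : Fin (m + 1) → Bool) ≠ Fin.cons true r := fun h => by
      simpa using congrFun h 0
    simp [transferProd_nil, this]
  | cons y ys ih =>
    choose p hp he using ih
    have hlin : ∀ z : R, (Polynomial.C z - Polynomial.C q * Polynomial.X).degree ≤ 1 := fun z => by
      compute_degree
    have hprod : (ys.map fun z => Polynomial.C z - Polynomial.C q * Polynomial.X).prod.degree ≤
        (ys.length : WithBot ℕ) := by
      clear he hp p
      induction ys with
      | nil => simp
      | cons z ys ih =>
        rw [List.map_cons, List.prod_cons, List.length_cons, Nat.cast_add, Nat.cast_one, add_comm]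
        exact (Polynomial.degree_mul_le _ _).trans (add_le_add (hlin z) ih)
    refine ⟨(Polynomial.X - Polynomial.C (q * y)) *
        ∑ k, Polynomial.C (columnTransfer q u w y l k) * p k +
      Polynomial.C ((1 - q ^ 2) * y * ∑ k, monodromy q u m w y l k true true *
        transferProd q u w ys k r) *
          (ys.map fun z => Polynomial.C z - Polynomial.C q * Polynomial.X).prod, ?_, fun x => ?_⟩
    · rw [List.length_cons]
      refine (Polynomial.degree_add_le _ _).trans_lt (max_lt ?_ ?_)
      · have hs : (∑ k, Polynomial.C (columnTransfer q u w y l k) * p k).degree < ys.length := by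
          refine (Polynomial.degree_sum_le _ _).trans_lt ?_
          rw [Finset.sup_lt_iff (by exact_mod_cast WithBot.bot_lt_coe _)]
          intro k _
          refine (Polynomial.degree_mul_le _ _).trans_lt ?_
          exact lt_of_le_of_lt (add_le_of_nonpos_left Polynomial.degree_C_le) (hp k)
        by_cases h0 : (∑ k, Polynomial.C (columnTransfer q u w y l k) * p k) = 0
        · rw [h0, mul_zero, Polynomial.degree_zero]
          exact_mod_cast WithBot.bot_lt_coe _
        · rw [Polynomial.degree_eq_natDegree h0] at hs
          have hs' : (∑ k, Polynomial.C (columnTransfer q u w y l k) * p k).natDegree <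
            ys.length := by exact_mod_cast hs
          refine (Polynomial.degree_mul_le _ _).trans_lt ?_
          rw [Polynomial.degree_X_sub_C, Polynomial.degree_eq_natDegree h0]
          have : 1 + (∑ k, Polynomial.C (columnTransfer q u w y l k) * p k).natDegree <
            ys.length + 1 := by omega
          exact_mod_cast this
      · refine (Polynomial.degree_mul_le _ _).trans_lt ?_
        refine lt_of_le_of_lt (add_le_of_nonpos_left Polynomial.degree_C_le) (hprod.trans_lt ?_)
        exact_mod_cast Nat.lt_succ_self _
    · rw [transferProd_false_true]
      have hev : Polynomial.eval x
          (ys.map fun z => Polynomial.C z - Polynomial.C q * Polynomial.X).prod =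
            (ys.map fun z => z - q * x).prod := by
        rw [← Polynomial.coe_evalRingHom, map_list_prod, List.map_map]
        congr 2
        ext z
        simp
      simp only [Polynomial.eval_add, Polynomial.eval_mul, Polynomial.eval_sub, Polynomial.eval_X,
        Polynomial.eval_C, Polynomial.eval_finsetSum, he, hev]
      ring

end SixVertex

/-! ### The partition function as Kostov's determinant. -/

section KostovDeterminant

open Matrix Polynomial

variable {R : Type*} [CommRing R]

/-- Kostov's matrix, whose determinant is the domain wall partition function times a Vandermonde
determinant. The parameter `u` stands for `q⁻¹`. -/
def kostovMatrix (q u : R) {m N : ℕ} (w : Fin m → R) (y : Fin N → R) : Matrix (Fin N) (Fin N) R :=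
  Matrix.of fun i j => (u * y i) ^ (j : ℕ) * ∏ k, (w k - q * y i) -
    (q * y i) ^ (j : ℕ) * ∏ k, (w k - u * y i)

/-- At `x = q * y 0` one of the two products in row 0 vanishes, leaving a geometric progression of
ratio `q * y 0`. Subtracting that multiple of the preceding column clears the row, and each row of
the minor acquires a scalar factor. -/
theorem det_kostovMatrix_frozen {q u : R} (hu : q * u = 1) {n : ℕ} (w : Fin n → R)
    (y : Fin (n + 1) → R) :
    (kostovMatrix q u (Fin.cons (q * y 0) w : Fin (n + 1) → R) y).det =
      (u - q) * y 0 * (∏ k, (w k - u * y 0)) *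
        (∏ i : Fin n, (y 0 - y i.succ) * (y i.succ - q * (q * y 0))) *
        (kostovMatrix q u w (Fin.tail y)).det := by
  set A := kostovMatrix q u (Fin.cons (q * y 0) w : Fin (n + 1) → R) y with hA
  let B : Matrix (Fin (n + 1)) (Fin (n + 1)) R := Matrix.of fun i j =>
    Fin.cases (motive := fun _ => R) (A i 0) (fun k => A i k.succ - q * y 0 * A i k.castSucc) j
  have hAB : A.det = B.det :=
    det_eq_of_forall_col_eq_smul_add_pred (fun _ => q * y 0) (fun i => rfl) fun i j => by
      simp [B]
  have hB0 : ∀ k : Fin n, B 0 k.succ = 0 := fun k => by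
    simp only [B, hA, kostovMatrix, Matrix.of_apply, Fin.cases_succ, Fin.prod_univ_succ,
      Fin.cons_zero, Fin.val_succ, Fin.val_castSucc]
    ring
  have hB : B.submatrix Fin.succ Fin.succ = Matrix.of fun i j =>
      ((y 0 - y i.succ) * (y i.succ - q * (q * y 0))) * kostovMatrix q u w (Fin.tail y) i j := by
    ext i j
    simp only [B, hA, kostovMatrix, Matrix.of_apply, Fin.cases_succ, Fin.prod_univ_succ,
      Fin.cons_zero, Fin.cons_succ, Fin.val_succ, Fin.val_castSucc, Matrix.submatrix_apply, Fin.tail]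
    generalize ∏ k, (w k - q * y i.succ) = a
    generalize ∏ k, (w k - u * y i.succ) = b
    have h1 : (u * y i.succ) ^ (j : ℕ) = u ^ (j : ℕ) * y i.succ ^ (j : ℕ) := mul_pow _ _ _
    grind
  rw [hAB, det_succ_row_zero, Fin.sum_univ_succ, Finset.sum_eq_zero fun k _ => by rw [hB0]; ring,
    Fin.succAbove_zero, hB, Matrix.det_mul_column]
  simp only [B, hA, kostovMatrix, Matrix.of_apply, Fin.cases_zero, Fin.prod_univ_succ,
      Fin.cons_zero, Fin.cons_succ, Fin.val_zero]
  ring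

theorem det_vandermonde_succ {n : ℕ} (y : Fin (n + 1) → R) :
    (vandermonde y).det = (∏ i : Fin n, (y i.succ - y 0)) * (vandermonde (Fin.tail y)).det := by
  rw [det_vandermonde, det_vandermonde, Fin.prod_univ_succ, Fin.prod_Ioi_zero]
  congr 1
  refine Finset.prod_congr rfl fun i _ => ?_
  rw [Fin.prod_Ioi_succ]
  rfl

/-- The matrix is `x • A + B`, so the degree is at most `n + 1`, and the coefficient in that degree
is `det A`. It vanishes because the coefficients of ∏ (w k - X) form a nonzero kernel vector of `A`.
-/
theorem det_kostovMatrix_polynomial [IsDomain R] (q u : R) {n : ℕ} (w : Fin n → R)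
    (y : Fin (n + 1) → R) :
    ∃ p : R[X], p.degree < (n + 1 : ℕ) ∧ ∀ x, p.eval x =
      (kostovMatrix q u (Fin.cons x w : Fin (n + 1) → R) y).det := by
  set A : Matrix (Fin (n + 1)) (Fin (n + 1)) R := Matrix.of fun i j =>
    (u * y i) ^ (j : ℕ) * ∏ k, (w k - q * y i) - (q * y i) ^ (j : ℕ) * ∏ k, (w k - u * y i) with hA
  set B : Matrix (Fin (n + 1)) (Fin (n + 1)) R := Matrix.of fun i j =>
    (q * y i) ^ (j : ℕ) * (u * y i) * ∏ k, (w k - u * y i) -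
      (u * y i) ^ (j : ℕ) * (q * y i) * ∏ k, (w k - q * y i) with hB
  have hdet : A.det = 0 := by
    set c : R[X] := ∏ k, (C (w k) - X) with hc
    have hc0 : c ≠ 0 := Finset.prod_ne_zero_iff.2 fun k _ h => by
      have := congrArg (fun p => coeff p 1) h
      simp at this
    have hcd : c.natDegree < n + 1 := by
      have h1 : c.natDegree ≤ ∑ k : Fin n, (C (w k) - X : R[X]).natDegree :=
        natDegree_prod_le _ _
      have h2 : ∑ k : Fin n, (C (w k) - X : R[X]).natDegree ≤ ∑ k : Fin n, 1 :=
        Finset.sum_le_sum fun k _ => by compute_degree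
      simp at h2
      omega
    have hev : ∀ x, ∑ j : Fin (n + 1), c.coeff j * x ^ (j : ℕ) = ∏ k, (w k - x) := fun x => by
      rw [Fin.sum_univ_eq_sum_range fun j => c.coeff j * x ^ j, ← eval_eq_sum_range' hcd, hc,
        eval_prod]
      simp
    rw [← exists_mulVec_eq_zero_iff]
    refine ⟨fun j => c.coeff j, fun h => hc0 ?_, ?_⟩
    · ext j
      rcases lt_or_ge j (n + 1) with hj | hj
      · simpa using congrFun h ⟨j, hj⟩
      · rw [coeff_eq_zero_of_natDegree_lt (by omega), coeff_zero]
    · ext i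
      have h1 := hev (u * y i)
      have h2 := hev (q * y i)
      simp only [mulVec, dotProduct, hA, of_apply, Pi.zero_apply]
      calc _ = (∑ j : Fin (n + 1), c.coeff j * (u * y i) ^ (j : ℕ)) * ∏ k, (w k - q * y i) -
            (∑ j : Fin (n + 1), c.coeff j * (q * y i) ^ (j : ℕ)) * ∏ k, (w k - u * y i) := by
              rw [Finset.sum_mul, Finset.sum_mul, ← Finset.sum_sub_distrib]
              exact Finset.sum_congr rfl fun j _ => by ring
        _ = 0 := by rw [h1, h2]; ring
  refine ⟨((X : R[X]) • A.map (C : R →+* R[X]) + B.map (C : R →+* R[X])).det, ?_, fun x => ?_⟩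
  · have h1 := natDegree_det_X_add_C_le A B
    have h2 := coeff_det_X_add_C_card A B
    rw [Fintype.card_fin] at h1 h2
    refine lt_of_le_of_ne (natDegree_le_iff_degree_le.1 h1) fun h => ?_
    exact Polynomial.coeff_ne_zero_of_eq_degree (R := R) h (h2.trans hdet)
  · rw [← coe_evalRingHom, RingHom.map_det]
    congr 1
    ext i j
    simp [hA, hB, kostovMatrix, Fin.prod_univ_succ, eval_prod]
    ring

theorem partitionFunction_mul_det_vandermonde_frozen {q u : R} (hu : q * u = 1) {n : ℕ}
    (ih : ∀ (w : Fin n → R) (y : Fin n → R), Function.Injective y →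
      (∀ i j, y j ≠ q ^ 2 * y i) → partitionFunction q u w (List.ofFn y) * (vandermonde y).det =
        q ^ (n + 1).choose 2 * (kostovMatrix q u w y).det)
    (w : Fin n → R) (y : Fin (n + 1) → R) (hy : Function.Injective y)
    (hq : ∀ i j, y j ≠ q ^ 2 * y i) :
    partitionFunction q u (Fin.cons (q * y 0) w : Fin (n + 1) → R) (List.ofFn y) *
        (vandermonde y).det =
      q ^ (n + 2).choose 2 *
        (kostovMatrix q u (Fin.cons (q * y 0) w : Fin (n + 1) → R) y).det := by
  have h := ih w (Fin.tail y) (hy.comp (Fin.succ_injective n)) fun i j => hq i.succ j.succ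
  have e : (n + 2).choose 2 = (n + 1) + (n + 1).choose 2 := by
    rw [Nat.choose_succ_succ', Nat.choose_one_right]
  have hw : ∏ k, (y 0 - q * w k) = (-q) ^ n * ∏ k, (w k - u * y 0) := by
    rw [← Fin.prod_const, ← Finset.prod_mul_distrib]
    exact Finset.prod_congr rfl fun k _ => by linear_combination -y 0 * hu
  have hm : ∏ i : Fin n, (y 0 - y i.succ) * (y i.succ - q * (q * y 0)) =
      (-1) ^ n * (∏ i : Fin n, (y i.succ - y 0)) * ∏ i : Fin n, (y i.succ - q * (q * y 0)) := by
    rw [← Fin.prod_const, ← Finset.prod_mul_distrib, ← Finset.prod_mul_distrib]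
    exact Finset.prod_congr rfl fun k _ => by ring
  have hl : ((List.ofFn fun i : Fin n => y i.succ).map fun z => z - q * (q * y 0)).prod =
      ∏ i : Fin n, (y i.succ - q * (q * y 0)) := by
    rw [List.map_ofFn, List.prod_ofFn]
    rfl
  rw [List.ofFn_succ, partitionFunction_frozen, det_kostovMatrix_frozen hu, det_vandermonde_succ,
    hl, hw, hm, e, pow_add]
  change partitionFunction q u w (List.ofFn fun i : Fin n => y i.succ) *
    (vandermonde (Fin.tail y)).det = _ at h
  have hs : ((-1) ^ n * (-1) ^ n : R) = 1 := by rw [← mul_pow]; simp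
  have hqq : (1 - q ^ 2) = q * (u - q) := by linear_combination -hu
  rw [hqq, neg_pow q n]
  linear_combination (u - q) * q * (-1) ^ n * q ^ n * y 0 * (∏ k, (w k - u * y 0)) *
    (∏ i : Fin n, (y i.succ - y 0)) * (∏ i : Fin n, (y i.succ - q * (q * y 0))) * h

/-- The Izergin-Korepin theorem, with the determinant in Kostov's form. -/
theorem partitionFunction_mul_det_vandermonde [IsDomain R] {q u : R} (hu : q * u = 1) {n : ℕ}
    (w y : Fin n → R) (hy : Function.Injective y) (hq : ∀ i j, y j ≠ q ^ 2 * y i) :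
    partitionFunction q u w (List.ofFn y) * (vandermonde y).det =
      q ^ (n + 1).choose 2 * (kostovMatrix q u w y).det := by
  induction n with
  | zero =>
    simp [partitionFunction, transferProd_nil, Subsingleton.elim (fun _ : Fin 0 => false) fun _ => true]
  | succ n ih =>
    obtain ⟨x, w, rfl⟩ : ∃ x w', w = Fin.cons x w' := ⟨w 0, Fin.tail w, (Fin.cons_self_tail w).symm⟩
    have h0 : ∀ k : Fin (n + 1),
        partitionFunction q u (Fin.cons (q * y k) w : Fin (n + 1) → R) (List.ofFn y) *
          (vandermonde y).det =
        q ^ (n + 2).choose 2 *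
          (kostovMatrix q u (Fin.cons (q * y k) w : Fin (n + 1) → R) y).det := by
      intro k
      -- Moving column `k` to the front changes both determinants by the sign of `σ` and fixes the
      -- partition function, so the frozen case yields every node `q * y k`.
      set σ := Equiv.swap 0 k
      have h := partitionFunction_mul_det_vandermonde_frozen hu (fun w y hy hq => ih w y hy hq) w
        (y ∘ σ) (hy.comp σ.injective) fun i j => hq (σ i) (σ j)
      have h1 : vandermonde (y ∘ σ) = (vandermonde y).submatrix σ id := rfl
      have h2 : ∀ w : Fin (n + 1) → R,
        kostovMatrix q u w (y ∘ σ) = (kostovMatrix q u w y).submatrix σ id := fun _ => rfl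
      have h3 : (y ∘ σ) 0 = y k := by simp [σ]
      rw [h3, h1, h2, det_permute, det_permute,
        partitionFunction_perm hu _ (Equiv.Perm.ofFn_comp_perm σ y)] at h
      · have hs : (((Equiv.Perm.sign σ : ℤˣ) : ℤ) : R) * ((Equiv.Perm.sign σ : ℤˣ) : ℤ) = 1 := by
          rw [← Int.cast_mul, ← Units.val_mul, Int.units_mul_self]
          simp
        linear_combination (((Equiv.Perm.sign σ : ℤˣ) : ℤ) : R) * h +
          (q ^ (n + 2).choose 2 *
            (kostovMatrix q u (Fin.cons (q * y k) w : Fin (n + 1) → R) y).det -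
          partitionFunction q u (Fin.cons (q * y k) w : Fin (n + 1) → R) (List.ofFn y) *
            (vandermonde y).det) * hs
      · intro a ha b hb
        obtain ⟨i, rfl⟩ := (List.mem_ofFn' _ _).1 ha
        obtain ⟨j, rfl⟩ := (List.mem_ofFn' _ _).1 hb
        exact hq _ _
    obtain ⟨p, hp, hpe⟩ := transferProd_polynomial q u w (List.ofFn y) (fun _ => false) fun _ => true
    obtain ⟨r, hr, hre⟩ := det_kostovMatrix_polynomial q u w y
    have hb : ∀ b : Bool, (Fin.cons b fun _ => b : Fin (n + 1) → Bool) = fun _ => b := fun b => by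
      ext i
      refine Fin.cases rfl (fun i => rfl) i
    have hpe' : ∀ x, p.eval x =
        partitionFunction q u (Fin.cons x w : Fin (n + 1) → R) (List.ofFn y) := fun x => by
      rw [hpe, hb, hb, partitionFunction]
    rw [List.length_ofFn] at hp
    have hdeg : ∀ (s : R[X]) (c : R), s.degree < (n + 1 : ℕ) →
        (C c * s).degree < (Finset.univ : Finset (Fin (n + 1))).card := fun s c hs => by
      rw [Finset.card_univ, Fintype.card_fin]
      exact (degree_mul_le _ _).trans_lt
        (lt_of_le_of_lt (add_le_of_nonpos_left degree_C_le) hs)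
    have hq0 : q ≠ 0 := left_ne_zero_of_mul_eq_one hu
    -- Two polynomials of degree below `n + 1` agree at the `n + 1` distinct nodes `q * y k`.
    have := eq_of_degrees_lt_of_eval_index_eq (v := fun k => q * y k) Finset.univ
      (fun a _ b _ hab => hy (mul_left_cancel₀ hq0 hab)) (hdeg p (vandermonde y).det hp)
      (hdeg r (q ^ (n + 2).choose 2) hr) fun k _ => by
        simp only [eval_mul, eval_C, hpe', hre]
        rw [mul_comm, h0]
    have h := congrArg (eval x) this
    simp only [eval_mul, eval_C, hpe', hre] at h
    rw [mul_comm, h]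

end KostovDeterminant

/-! ### Coinciding column parameters through divided differences. -/

section HomogeneousLimit

open Matrix Polynomial

variable {R S : Type*} [CommRing R] [CommRing S]

/-- The iterated quotients of a polynomial by `X - y 0`, `X - y 1`, …; their values at `y m` are
the divided differences. -/
noncomputable def newtonQuotient (p : R[X]) (y : ℕ → R) : ℕ → R[X]
  | 0 => p
  | m + 1 => newtonQuotient p y m /ₘ (X - C (y m))

theorem newton_expansion (p : R[X]) (y : ℕ → R) (M : ℕ) :
    p = ∑ m ∈ Finset.range M, C ((newtonQuotient p y m).eval (y m)) *
        ∏ l ∈ Finset.range m, (X - C (y l)) +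
      (∏ l ∈ Finset.range M, (X - C (y l))) * newtonQuotient p y M := by
  induction M with
  | zero => simp [newtonQuotient]
  | succ M ih =>
    conv_lhs => rw [ih, ← modByMonic_add_div (newtonQuotient p y M) (X - C (y M)),
      modByMonic_X_sub_C_eq_C_eval]
    rw [Finset.sum_range_succ, Finset.prod_range_succ, newtonQuotient]
    ring

theorem map_newtonQuotient (f : R →+* S) (p : R[X]) (y : ℕ → R) (m : ℕ) :
    (newtonQuotient p y m).map f = newtonQuotient (p.map f) (fun i => f (y i)) m := by
  induction m with
  | zero => rfl
  | succ m ih =>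
    rw [newtonQuotient, map_divByMonic f (monic_X_sub_C _), ih, newtonQuotient]
    simp

/-- With all nodes equal to `a`, the Newton expansion is the expansion in powers of `X - a`; after
`m + 1` steps the remainder no longer affects the coefficient of degree `m`. -/
theorem eval_newtonQuotient_const (p : R[X]) (a : R) (m : ℕ) :
    (newtonQuotient p (fun _ => a) m).eval a = (taylor a p).coeff m := by
  have h := congrArg (fun r => (taylor a r).coeff m) (newton_expansion p (fun _ => a) (m + 1))
  simp only [Finset.prod_const, Finset.card_range, map_add, map_sum, taylor_mul, taylor_C,
    taylor_pow, map_sub, taylor_X, add_sub_cancel_right, coeff_add, finsetSum_coeff, coeff_C_mul,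
    coeff_X_pow, coeff_X_pow_mul'] at h
  rw [h]
  simp

/-- Newton interpolation: a determinant of values is a Vandermonde determinant times a determinant
of divided differences. -/
theorem det_eval_eq_det_vandermonde_mul {n : ℕ} (p : Fin n → R[X]) (y : ℕ → R) :
    (Matrix.of fun i j : Fin n => (p j).eval (y i)).det =
      (vandermonde fun i : Fin n => y i).det *
        (Matrix.of fun m j : Fin n => (newtonQuotient (p j) y m).eval (y m)).det := by
  nontriviality R
  rw [det_eval_matrixOfPolynomials_eq_det_vandermonde (fun i : Fin n => y i)
    (fun m : Fin n => ∏ l ∈ Finset.range m, (X - C (y l))), ← det_mul]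
  · congr 1
    ext i j
    have h := congrArg (eval (y i)) (newton_expansion (p j) y n)
    have h0 : ∏ l ∈ Finset.range n, (y i - y l) = 0 :=
      Finset.prod_eq_zero (Finset.mem_range.2 i.2) (sub_self _)
    simp only [eval_add, eval_finsetSum, eval_mul, eval_C, eval_prod, eval_sub, eval_X, h0,
      zero_mul, add_zero] at h
    rw [of_apply, h, mul_apply, Finset.sum_range]
    refine Finset.sum_congr rfl fun m _ => ?_
    simp only [of_apply, eval_prod, eval_sub, eval_X, eval_C]
    ring
  · intro m
    rw [natDegree_prod_of_monic _ _ fun l _ => monic_X_sub_C _]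
    simp
  · exact fun m => monic_prod_of_monic _ _ fun l _ => monic_X_sub_C _

theorem map_monodromy (f : R →+* S) (q u : R) (m : ℕ) (w : Fin m → R) (y : R)
    (l r : Fin m → Bool) :
    (monodromy q u m w y l r).map f = monodromy (f q) (f u) m (f ∘ w) (f y) l r := by
  induction m with
  | zero => simp [monodromy]
  | succ m ih =>
    rw [monodromy, monodromy, Matrix.map_mul, ih]
    congr 1
    ext a b
    simp only [vertexMatrix, Matrix.map_apply, Matrix.of_apply, Function.comp_apply]
    split <;> simp

theorem map_partitionFunction (f : R →+* S) (q u : R) {m : ℕ} (w : Fin m → R) (ys : List R) :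
    f (partitionFunction q u w ys) = partitionFunction (f q) (f u) (f ∘ w) (ys.map f) := by
  have h : ∀ y, (columnTransfer q u w y).map f = columnTransfer (f q) (f u) (f ∘ w) (f y) :=
    fun y => by
      ext l r
      rw [Matrix.map_apply, columnTransfer, columnTransfer, of_apply, of_apply, ← map_monodromy]
      rfl
  have h2 : (transferProd q u w ys).map f = transferProd (f q) (f u) (f ∘ w) (ys.map f) := by
    induction ys with
    | nil => simp [transferProd_nil]
    | cons y ys ih => rw [List.map_cons, transferProd_cons, transferProd_cons, Matrix.map_mul, h, ih]
  rw [partitionFunction, partitionFunction, ← h2]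
  rfl

/-- The partition function with homogeneous column parameters. -/
theorem partitionFunction_replicate_one {F : Type*} [Field F] [CharZero F] {q u : F}
    (hu : q * u = 1) (hq : q ^ 2 ≠ 1) {n : ℕ} (w : Fin n → F) (p : Fin n → F[X])
    (hp : ∀ j, X * p j = (C u * X) ^ (j : ℕ) * ∏ k, (C (w k) - C q * X) -
      (C q * X) ^ (j : ℕ) * ∏ k, (C (w k) - C u * X)) :
    partitionFunction q u w (List.replicate n 1) =
      q ^ (n + 1).choose 2 * (Matrix.of fun i j : Fin n => (taylor 1 (p j)).coeff i).det := by
  -- These nodes are distinct over `F[X]`, so the Vandermonde determinant can be cancelled there; at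
  -- `X = 0` they all become 1.
  let y : ℕ → F[X] := fun i => 1 + C (i : F) * X
  have hy : Function.Injective fun i : Fin n => y i := fun i j hij => by
    have := congrArg (fun r => coeff r 1) hij
    simpa [y, coeff_one, Fin.ext_iff] using this
  have hqy : ∀ i j : Fin n, y j ≠ C q ^ 2 * y i := fun i j h => by
    have := congrArg (eval 0) h
    simp [y] at this
    exact hq this.symm
  have hK := partitionFunction_mul_det_vandermonde (q := C q) (u := C u)
    (by rw [← C_mul, hu, C_1]) (C ∘ w) (fun i => y i) hy hqy
  have hE : kostovMatrix (C q) (C u) (C ∘ w) (fun i : Fin n => y i) =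
      Matrix.of fun i j : Fin n => y i * ((p j).map C).eval (y i) := by
    ext1 i j
    have := congrArg (fun r => (r.map C).eval (y i)) (hp j)
    simp [eval_prod, Polynomial.map_prod] at this
    rw [of_apply, this]
    simp [kostovMatrix]
  have hdet := Matrix.det_mul_column (fun i : Fin n => y i)
    (Matrix.of fun i j : Fin n => ((p j).map C).eval (y i))
  simp only [of_apply] at hdet
  rw [hE, hdet, det_eval_eq_det_vandermonde_mul] at hK
  have hV : (vandermonde fun i : Fin n => y i).det ≠ 0 := det_vandermonde_ne_zero_iff.2 hy
  have hZ := mul_right_cancel₀ hV (hK.trans (by ring :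
    _ = (C q ^ (n + 1).choose 2 * (∏ i : Fin n, y i) * (Matrix.of fun m j : Fin n =>
      (newtonQuotient ((p j).map C) y m).eval (y m)).det) * (vandermonde fun i : Fin n => y i).det))
  have h0 := congrArg (evalRingHom (0 : F)) hZ
  have hy0 : ∀ i, eval 0 (y i) = 1 := fun i => by simp [y]
  have hc : (evalRingHom (0 : F)).comp C = RingHom.id F := by ext; simp
  rw [map_partitionFunction, map_mul, map_mul, map_prod, RingHom.map_det] at h0
  have hl : (List.ofFn fun i : Fin n => y i).map (evalRingHom (0 : F)) = List.replicate n 1 := by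
    rw [List.map_ofFn, ← List.ofFn_const]
    congr 1
    ext i
    exact hy0 i
  have hw : (evalRingHom (0 : F)) ∘ C ∘ w = w := by ext; simp
  rw [hl, hw] at h0
  simp only [coe_evalRingHom, eval_C, eval_pow, hy0, Finset.prod_const_one, mul_one] at h0
  rw [h0]
  congr 2
  ext i j
  rw [RingHom.mapMatrix_apply, Matrix.map_apply, of_apply, of_apply, ← eval_newtonQuotient_const,
    ← eval₂_hom, ← eval_map, map_newtonQuotient, Polynomial.map_map, hc, Polynomial.map_id]
  simp only [coe_evalRingHom, hy0]

end HomogeneousLimit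

/-! ### The matrix K as the homogeneous limit of Kostov's matrix. -/

section KMatrix

open Polynomial

variable {F : Type*} [Field F]

theorem intBinom_natCast (a b : ℕ) : intBinom a b = (a.choose b : ℤ) := by
  simp [intBinom, Ring.choose_natCast]

theorem intBinom_natCast_eq_zero {a : ℕ} {b : ℤ} (h : b < 0 ∨ (a : ℤ) < b) :
    intBinom a b = 0 := by
  rcases h with h | h
  · simp [intBinom, not_le.2 h]
  · lift b to ℕ using by omega
    rw [intBinom_natCast, Nat.choose_eq_zero_of_lt (by exact_mod_cast h), Nat.cast_zero]

/-- The polynomial whose Taylor coefficients at `1` form a column of `kMatrix`. -/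
noncomputable def kPolynomial (n : ℕ) (q ρ : F) (j : ℕ) : F[X] :=
  ∑ k ∈ Finset.Icc (-(n : ℤ) + 1) (n : ℤ),
    C ((-1 : F) ^ (k + 1) * ((q ^ k - q ^ (-k)) / (q - q⁻¹)) *
      ((1 + ρ * q) * (intBinom ((n : ℤ) - 1) (k + (j - 1)) : F)
        + (ρ + q) * (intBinom ((n : ℤ) - 1) (k + j) : F))) * X ^ (2 * j + k - 1 : ℤ).toNat

/-- Hence the truncation by `toNat` in the exponents of `kPolynomial` is harmless: either `k = 0`
and the q-number vanishes, or both lower binomial indices are negative. -/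
theorem kPolynomial_term_eq_zero {n : ℕ} (q ρ : F) {j : ℕ} {k : ℤ} (hk : 2 * j + k - 1 < 0) :
    (-1 : F) ^ (k + 1) * ((q ^ k - q ^ (-k)) / (q - q⁻¹)) *
      ((1 + ρ * q) * (intBinom (n : ℤ) (k + (j - 1)) : F)
        + (ρ + q) * (intBinom (n : ℤ) (k + j) : F)) = 0 := by
  rcases eq_or_ne k 0 with rfl | h0
  · simp
  · rw [intBinom_natCast_eq_zero (by omega), intBinom_natCast_eq_zero (by omega)]
    simp

theorem coeff_taylor_kPolynomial (n : ℕ) (q ρ : F) (i j : ℕ) :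
    (taylor 1 (kPolynomial (n + 1) q ρ j)).coeff i = kEntry (n + 1) q ρ (i + 1) (j + 1) := by
  rw [kPolynomial, kEntry, map_sum, finsetSum_coeff]
  refine Finset.sum_congr rfl fun k _ => ?_
  have e0 : ((n + 1 : ℕ) : ℤ) - 1 = n := by push_cast; ring
  have e1 : ((j : ℤ) + 1) + k - 2 = k + (j - 1) := by ring
  have e2 : ((j : ℤ) + 1) + k - 1 = k + j := by ring
  have e3 : 2 * ((j : ℤ) + 1) + k - 3 = 2 * j + k - 1 := by ring
  rw [e0, e1, e2, e3, add_sub_cancel_right, taylor_mul, taylor_C, coeff_C_mul, taylor_pow,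
    taylor_X, C_1, coeff_X_add_one_pow, mul_right_comm]
  rcases lt_or_ge (2 * (j : ℤ) + k - 1) 0 with hk | hk
  · rw [mul_right_comm, kPolynomial_term_eq_zero q ρ hk, mul_right_comm,
      kPolynomial_term_eq_zero q ρ hk, zero_mul, zero_mul]
  · obtain ⟨N, hN⟩ := Int.eq_ofNat_of_zero_le hk
    rw [hN, intBinom_natCast, Int.toNat_natCast]
    push_cast
    ring

/-- The bounds on `s` are those for which the range of `k` contains the whole support of the
binomial coefficient; `s = -1` arises from `j - 1` at `j = 0`. -/
theorem sum_mul_intBinom {M : Type*} [CommRing M] (n : ℕ) (s : ℤ) (h1 : -1 ≤ s) (h2 : s ≤ n)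
    (f : ℤ → M) :
    ∑ k ∈ Finset.Icc (-((n + 1 : ℕ) : ℤ) + 1) ((n + 1 : ℕ) : ℤ),
      f k * (intBinom (n : ℤ) (k + s) : M) =
    ∑ m ∈ Finset.range (n + 1), f (m - s) * (n.choose m : M) := by
  symm
  refine Finset.sum_of_injOn (fun m : ℕ => (m : ℤ) - s) ?_ ?_ ?_ ?_
  · intro a _ b _ h
    simpa using h
  · intro m hm
    simp only [Finset.coe_range, Set.mem_Iio, Finset.coe_Icc, Set.mem_Icc] at hm ⊢
    omega
  · intro k _ hk
    rw [intBinom_natCast_eq_zero, Int.cast_zero, mul_zero]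
    by_contra! h
    refine hk ⟨(k + s).toNat, ?_, ?_⟩
    · simp only [Finset.coe_range, Set.mem_Iio]
      omega
    · simp only
      omega
  · intro m _
    rw [sub_add_cancel, intBinom_natCast, Int.cast_natCast]

theorem signed_qNumber_sub {q : F} (hq : q ≠ 0) (a b : ℕ) :
    (-1 : F) ^ ((a : ℤ) - b + 1) *
        ((q ^ ((a : ℤ) - b) - q ^ (-((a : ℤ) - b))) / (q - q⁻¹)) =
      (-1) ^ (a + b + 1) * (q⁻¹ ^ b * q ^ a - q ^ b * q⁻¹ ^ a) * (q - q⁻¹)⁻¹ := by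
  have h1 : (-1 : F) ^ ((a : ℤ) - b + 1) = (-1) ^ (a + b + 1) := by
    have : (a : ℤ) - b + 1 = ((a + b + 1 : ℕ) : ℤ) - ((2 * b : ℕ) : ℤ) := by push_cast; ring
    rw [this, zpow_sub₀ (by simp), zpow_natCast, zpow_natCast, pow_mul]
    simp
  rw [h1, neg_sub, zpow_sub₀ hq, zpow_sub₀ hq]
  simp only [zpow_natCast, inv_pow]
  ring

/-- The right side is a column of Kostov's matrix with one row parameter (ρ + q)/(1 + ρq) and the
others 1, cleared of denominators. Expanding the `n`-th powers binomially gives the sum over `k`,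
the two terms of the linear factor giving the two binomials. -/
theorem X_mul_kPolynomial {n j : ℕ} {q : F} (ρ : F) (hq : q ≠ 0) (hj : j ≤ n) :
    X * kPolynomial (n + 1) q ρ j =
      C ((-1) ^ (j + 1) * (q - q⁻¹)⁻¹) *
        ((C q⁻¹ * X) ^ j * ((C (ρ + q) - C (1 + ρ * q) * (C q * X)) * (1 - C q * X) ^ n) -
          (C q * X) ^ j * ((C (ρ + q) - C (1 + ρ * q) * (C q⁻¹ * X)) * (1 - C q⁻¹ * X) ^ n)) := by
  have e0 : ((n + 1 : ℕ) : ℤ) - 1 = n := by push_cast; ring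
  set f : ℤ → F[X] := fun k => C ((-1 : F) ^ (k + 1) * ((q ^ k - q ^ (-k)) / (q - q⁻¹))) *
    X ^ (2 * j + k : ℤ).toNat with hf
  have h : X * kPolynomial (n + 1) q ρ j =
      C (1 + ρ * q) * ∑ k ∈ Finset.Icc (-((n + 1 : ℕ) : ℤ) + 1) ((n + 1 : ℕ) : ℤ),
        f k * (intBinom (n : ℤ) (k + (j - 1)) : F[X]) +
      C (ρ + q) * ∑ k ∈ Finset.Icc (-((n + 1 : ℕ) : ℤ) + 1) ((n + 1 : ℕ) : ℤ),
        f k * (intBinom (n : ℤ) (k + j) : F[X]) := by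
    rw [kPolynomial, Finset.mul_sum, Finset.mul_sum, Finset.mul_sum, ← Finset.sum_add_distrib]
    refine Finset.sum_congr rfl fun k _ => ?_
    have e : C (1 + ρ * q) * (f k * (intBinom (n : ℤ) (k + (j - 1)) : F[X])) +
        C (ρ + q) * (f k * (intBinom (n : ℤ) (k + j) : F[X])) =
        C ((-1 : F) ^ (k + 1) * ((q ^ k - q ^ (-k)) / (q - q⁻¹)) *
      ((1 + ρ * q) * (intBinom (n : ℤ) (k + (j - 1)) : F)
        + (ρ + q) * (intBinom (n : ℤ) (k + j) : F))) * X ^ (2 * j + k : ℤ).toNat := by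
      simp only [hf, C_mul, C_add, map_intCast]
      ring
    rw [e, e0]
    rcases lt_or_ge (2 * (j : ℤ) + k - 1) 0 with hk | hk
    · rw [kPolynomial_term_eq_zero q ρ hk]
      simp
    · have : (2 * (j : ℤ) + k).toNat = (2 * (j : ℤ) + k - 1).toNat + 1 := by omega
      rw [this, pow_succ]
      ring
  have f1 : ∀ m : ℕ, f (m - (j - 1)) =
      C ((-1) ^ (m + j) * (q⁻¹ ^ j * q ^ (m + 1) - q ^ j * q⁻¹ ^ (m + 1)) * (q - q⁻¹)⁻¹) *
        X ^ (j + m + 1) := fun m => by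
    have e : (m : ℤ) - (j - 1) = ((m + 1 : ℕ) : ℤ) - j := by push_cast; ring
    have e' : (2 * (j : ℤ) + (((m + 1 : ℕ) : ℤ) - j)).toNat = j + m + 1 := by omega
    simp only [hf]
    rw [e, signed_qNumber_sub hq, e', show m + 1 + j + 1 = m + j + 2 by ring, pow_add _ (m + j) 2]
    simp
  have f2 : ∀ m : ℕ, f (m - j) =
      C ((-1) ^ (m + j + 1) * (q⁻¹ ^ j * q ^ m - q ^ j * q⁻¹ ^ m) * (q - q⁻¹)⁻¹) *
        X ^ (j + m) := fun m => by
    have e' : (2 * (j : ℤ) + ((m : ℤ) - j)).toNat = j + m := by omega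
    simp only [hf]
    rw [signed_qNumber_sub hq, e']
  have hb : ∀ a : F, (1 - C a * X) ^ n =
      ∑ m ∈ Finset.range (n + 1), (-1) ^ m * C a ^ m * X ^ m * (n.choose m : F[X]) := fun a => by
    rw [sub_eq_neg_add, add_pow]
    refine Finset.sum_congr rfl fun m _ => ?_
    rw [one_pow, mul_one, neg_pow, mul_pow]
    ring
  rw [h, sum_mul_intBinom n _ (by omega) (by omega), sum_mul_intBinom n _ (by omega) (by omega),
    hb, hb]
  simp only [f1, f2]
  simp only [Finset.mul_sum]
  rw [← Finset.sum_add_distrib, ← Finset.sum_sub_distrib, Finset.mul_sum]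
  refine Finset.sum_congr rfl fun m _ => ?_
  simp only [C_mul, C_add, C_sub, C_pow, C_neg, C_1]
  ring

theorem kMatrix_apply (n : ℕ) (q ρ : F) (i j : Fin (n + 1)) :
    kMatrix (n + 1) q ρ i j = (taylor 1 (kPolynomial (n + 1) q ρ j)).coeff i :=
  (coeff_taylor_kPolynomial n q ρ i j).symm

theorem partitionFunction_eq_det_kMatrix [CharZero F] {n : ℕ} {q ρ : F} (hq0 : q ≠ 0)
    (hq : q ^ 2 ≠ 1) (hρ : 1 + ρ * q ≠ 0) :
    partitionFunction q q⁻¹ (Fin.cons ((ρ + q) / (1 + ρ * q)) fun _ => 1 : Fin (n + 1) → F)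
        (List.replicate (n + 1) 1) =
      (q * (q⁻¹ - q)) ^ (n + 1) * ((1 + ρ * q) ^ (n + 1))⁻¹ * (-q) ^ (n + 1).choose 2 *
        (kMatrix (n + 1) q ρ).det := by
  have hqq : q - q⁻¹ ≠ 0 := fun h => hq (by
    have := sub_eq_zero.1 h
    rw [pow_two]
    nth_rewrite 2 [this]
    exact mul_inv_cancel₀ hq0)
  -- The inverse of the scalar in `X_mul_kPolynomial`, with the denominator 1 + ρq of the first row
  -- parameter restored.
  set c : Fin (n + 1) → F := fun j => (-1) ^ (j : ℕ) * ((q⁻¹ - q) * (1 + ρ * q)⁻¹) with hc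
  rw [partitionFunction_replicate_one (mul_inv_cancel₀ hq0) hq _
    fun j => C (c j) * kPolynomial (n + 1) q ρ j]
  · have h := Matrix.det_mul_row c (kMatrix (n + 1) q ρ)
    have hk : (Matrix.of fun i j : Fin (n + 1) =>
        (taylor 1 (C (c j) * kPolynomial (n + 1) q ρ j)).coeff i) =
        Matrix.of fun i j => c j * kMatrix (n + 1) q ρ i j := by
      ext i j
      rw [Matrix.of_apply, Matrix.of_apply, kMatrix_apply, taylor_mul, taylor_C, coeff_C_mul]
    have hprod : ∏ j, c j = (-1) ^ (n + 1).choose 2 * ((q⁻¹ - q) * (1 + ρ * q)⁻¹) ^ (n + 1) := by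
      rw [Finset.prod_mul_distrib, Finset.prod_const, Finset.card_univ, Fintype.card_fin,
        Fin.prod_univ_eq_prod_range fun j => (-1 : F) ^ j, Finset.prod_pow_eq_pow_sum,
        Finset.sum_range_id, Nat.choose_two_right]
    have he : (n + 2).choose 2 = (n + 1) + (n + 1).choose 2 := by
      rw [Nat.choose_succ_succ', Nat.choose_one_right]
    rw [hk, h, hprod, he, pow_add, mul_pow, mul_pow, inv_pow, neg_pow q]
    ring
  · intro j
    have hw : C ((ρ + q) / (1 + ρ * q)) = C (1 + ρ * q)⁻¹ * C (ρ + q) := by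
      rw [← C_mul, div_eq_inv_mul]
    have h1 : C (1 + ρ * q)⁻¹ * C (1 + ρ * q) = 1 := by
      rw [← C_mul, inv_mul_cancel₀ hρ, C_1]
    have h2 : C (q⁻¹ - q) * C (q - q⁻¹)⁻¹ = -1 := by
      rw [← C_mul, ← neg_sub, neg_mul, mul_inv_cancel₀ hqq, C_neg, C_1]
    have h3 : ((-1) ^ (j : ℕ) * (-1) ^ (j : ℕ) : F[X]) = 1 := by rw [← mul_pow]; simp
    rw [mul_left_comm, X_mul_kPolynomial ρ hq0 (Nat.lt_succ_iff.1 j.2)]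
    simp only [Fin.prod_univ_succ, Fin.cons_zero, Fin.cons_succ, C_1, Finset.prod_const,
      Finset.card_univ, Fintype.card_fin, hw, hc]
    simp only [C_mul, C_pow, C_neg, C_1, pow_succ (-1 : F[X]) (j : ℕ)]
    generalize C (q - q⁻¹)⁻¹ = d at *
    generalize C (q⁻¹ - q) = d' at *
    generalize C (1 + ρ * q)⁻¹ = e at *
    generalize hA : (C q⁻¹ * X : F[X]) = A
    generalize (1 - A) ^ n = A'
    generalize hB : (C q * X : F[X]) = B
    generalize (1 - B) ^ n = B'
    generalize (C (ρ + q) : F[X]) = s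
    generalize A ^ (j : ℕ) = A2
    generalize B ^ (j : ℕ) = B2
    have hs : (-1 : F[X]) ^ (j : ℕ) * (d' * e) * ((-1) ^ (j : ℕ) * -1 * d) = e := by
      linear_combination (-(e * d' * d)) * h3 - e * h2
    rw [← mul_assoc, hs]
    linear_combination (-(A2 * B * B') + B2 * A * A') * h1

end KMatrix

/-! ### Alternating sign matrices as six-vertex configurations. -/

section ASMConfigurations

open Matrix

/-- The sum of the first `k` entries of a finite sequence. -/
def partialSum {n : ℕ} (v : Fin n → ℤ) (k : ℕ) : ℤ :=
  ∑ j ∈ Finset.range k, if h : j < n then v ⟨j, h⟩ else 0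

@[simp]
theorem partialSum_zero {n : ℕ} (v : Fin n → ℤ) : partialSum v 0 = 0 := rfl

theorem partialSum_succ {n : ℕ} (v : Fin n → ℤ) (j : Fin n) :
    partialSum v (j + 1) = partialSum v j + v j := by
  simp [partialSum, Finset.sum_range_succ]

theorem partialSum_succ' {n : ℕ} (v : Fin n → ℤ) {k : ℕ} (hk : k < n) :
    partialSum v (k + 1) = partialSum v k + v ⟨k, hk⟩ :=
  partialSum_succ v ⟨k, hk⟩

/-- Alternation only compares consecutive nonzero entries, so an induction showing that partial sums
are 0 or 1 must also carry the last nonzero entry seen. -/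
theorem IsAlternating.partialSum_state {n : ℕ} {v : Fin n → ℤ} (hv : IsAlternating v) {k : ℕ}
    (hk : k ≤ n) :
    (partialSum v k = 0 ∧ ((∀ j : Fin n, (j : ℕ) < k → v j = 0) ∨
      ∃ i : Fin n, (i : ℕ) < k ∧ v i = -1 ∧ ∀ j : Fin n, i < j → (j : ℕ) < k → v j = 0)) ∨
    (partialSum v k = 1 ∧
      ∃ i : Fin n, (i : ℕ) < k ∧ v i = 1 ∧ ∀ j : Fin n, i < j → (j : ℕ) < k → v j = 0) := by
  induction k with
  | zero => simp
  | succ k ih =>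
    have ih := ih (by omega)
    have hkn : k < n := by omega
    set c : Fin n := ⟨k, hkn⟩ with hc
    have hcv : (c : ℕ) = k := rfl
    have hP : partialSum v (k + 1) = partialSum v k + v c := partialSum_succ' v hkn
    have hsplit : ∀ j : Fin n, (j : ℕ) < k + 1 → (j : ℕ) < k ∨ j = c := fun j hj => by
      rcases Nat.lt_succ_iff_lt_or_eq.1 hj with h | h
      · exact Or.inl h
      · exact Or.inr (Fin.ext h)
    rw [hP]
    rcases hv.entry c with h0 | h1 | h1
    · rw [h0, add_zero]
      have hext : ∀ i : Fin n, (∀ j : Fin n, i < j → (j : ℕ) < k → v j = 0) →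
          ∀ j : Fin n, i < j → (j : ℕ) < k + 1 → v j = 0 := fun i hi j hij hj => by
        rcases hsplit j hj with h | rfl
        · exact hi j hij h
        · exact h0
      rcases ih with ⟨hp, hz | ⟨i, hi, hi1, hi2⟩⟩ | ⟨hp, i, hi, hi1, hi2⟩
      · refine Or.inl ⟨hp, Or.inl fun j hj => ?_⟩
        rcases hsplit j hj with h | rfl
        · exact hz j h
        · exact h0
      · exact Or.inl ⟨hp, Or.inr ⟨i, by omega, hi1, hext i hi2⟩⟩
      · exact Or.inr ⟨hp, i, by omega, hi1, hext i hi2⟩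
    · have hnew : ∀ j : Fin n, c < j → (j : ℕ) < k + 1 → v j = 0 := fun j hj hj' => by
        rw [Fin.lt_def] at hj
        omega
      rcases ih with ⟨hp, -⟩ | ⟨hp, i, hi, hi1, hi2⟩
      · exact Or.inr ⟨by rw [hp, h1]; rfl, c, by omega, h1, hnew⟩
      · have := hv.alternate i c hi (by omega) (by omega) fun j hij hj => hi2 j hij hj
        omega
    · have hnew : ∀ j : Fin n, c < j → (j : ℕ) < k + 1 → v j = 0 := fun j hj hj' => by
        rw [Fin.lt_def] at hj
        omega
      rcases ih with ⟨hp, hz | ⟨i, hi, hi1, hi2⟩⟩ | ⟨hp, i, hi, hi1, hi2⟩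
      · obtain ⟨i, hi, hlt⟩ := hv.first
        rcases lt_trichotomy i c with h | h | h
        · have := hz i h
          omega
        · subst h
          omega
        · have := hlt c h
          omega
      · have := hv.alternate i c hi (by omega) (by omega) fun j hij hj => hi2 j hij hj
        omega
      · exact Or.inl ⟨by rw [hp, h1]; rfl, Or.inr ⟨c, by omega, h1, hnew⟩⟩

theorem IsAlternating.partialSum_eq {n : ℕ} {v : Fin n → ℤ} (hv : IsAlternating v) {k : ℕ}
    (hk : k ≤ n) : partialSum v k = 0 ∨ partialSum v k = 1 :=
  (hv.partialSum_state hk).imp And.left And.left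

theorem IsAlternating.partialSum_self {n : ℕ} {v : Fin n → ℤ} (hv : IsAlternating v) :
    partialSum v n = 1 := by
  obtain ⟨i, hi, hlt⟩ := hv.last
  rcases hv.partialSum_state le_rfl with ⟨hp, hz | ⟨j, hj, hj1, hj2⟩⟩ | ⟨hp, -⟩
  · have := hz i i.2
    omega
  · rcases lt_trichotomy i j with h | rfl | h
    · have := hlt j h
      omega
    · omega
    · have := hj2 i h i.2
      omega
  · exact hp

/-- The first nonzero entry is where the partial sum first reaches 1, the last is where it leaves 0
for good. Between consecutive nonzero entries the sum is constant, so the second jump must undo the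
first. -/
theorem isAlternating_of_partialSum {n : ℕ} {v : Fin n → ℤ}
    (h01 : ∀ k ≤ n, partialSum v k = 0 ∨ partialSum v k = 1) (hn : partialSum v n = 1) :
    IsAlternating v := by
  have hs := fun j : Fin n => partialSum_succ v j
  have h0 := fun j : Fin n => h01 j j.2.le
  have h1 := fun j : Fin n => h01 (j + 1) j.2
  refine ⟨fun i => ?_, ?_, ?_, ?_⟩
  · have := hs i
    have := h0 i
    have := h1 i
    omega
  · have hex : ∃ k, partialSum v k = 1 := ⟨n, hn⟩
    classical
    have hk := Nat.find_spec hex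
    have hmin : ∀ k < Nat.find hex, partialSum v k ≠ 1 := fun k hk => Nat.find_min hex hk
    have hle : Nat.find hex ≤ n := Nat.find_min' hex hn
    generalize Nat.find hex = K at hk hmin hle
    obtain _ | K := K
    · simp at hk
    refine ⟨⟨K, hle⟩, ?_, fun j hj => ?_⟩
    · have h2 := partialSum_succ' v hle
      have := hmin K (by omega)
      have := h01 K (by omega)
      omega
    · rw [Fin.lt_def] at hj
      simp only at hj
      have := hmin j (by omega)
      have := hmin (j + 1) (by omega)
      have := hs j
      have := h0 j
      have := h1 j
      omega
  · classical
    have hK0 : partialSum v (Nat.findGreatest (fun k => partialSum v k = 0) n) = 0 :=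
      Nat.findGreatest_spec (P := fun k => partialSum v k = 0) (Nat.zero_le n) (partialSum_zero v)
    have hKle := Nat.findGreatest_le (P := fun k => partialSum v k = 0) n
    have hmax : ∀ k, Nat.findGreatest (fun k => partialSum v k = 0) n < k → k ≤ n →
        ¬ partialSum v k = 0 := fun k h1 h2 => Nat.findGreatest_is_greatest h1 h2
    generalize Nat.findGreatest (fun k => partialSum v k = 0) n = K at hK0 hKle hmax
    have hKn : K < n := lt_of_le_of_ne hKle fun h => by
      rw [h] at hK0
      omega
    refine ⟨⟨K, hKn⟩, ?_, fun j hj => ?_⟩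
    · have h2 := partialSum_succ' v hKn
      have := hmax (K + 1) (by omega) (by omega)
      have := h01 (K + 1) (by omega)
      omega
    · rw [Fin.lt_def] at hj
      simp only at hj
      have := hmax j (by omega) (by omega)
      have := hmax (j + 1) (by omega) (by omega)
      have := hs j
      have := h0 j
      have := h1 j
      omega
  · intro i j hij hi hj hz
    have hconst : ∀ k, (i : ℕ) + 1 ≤ k → k ≤ j → partialSum v k = partialSum v (i + 1) := by
      intro k hik
      induction k, hik using Nat.le_induction with
      | base => exact fun _ => rfl
      | succ k hik ih =>
        intro hkj
        have hkn : k < n := by omega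
        rw [partialSum_succ' v hkn, ih (by omega), hz ⟨k, hkn⟩ (Fin.lt_def.2 hik)
          (Fin.lt_def.2 hkj), add_zero]
    have := hconst j hij le_rfl
    have := hs i
    have := hs j
    have := h0 i
    have := h1 i
    have := h0 j
    have := h1 j
    omega

variable {R : Type*} [CommRing R]

/-- An entry of a product of matrices is a sum over paths. -/
theorem list_ofFn_prod_apply {S : Type*} [Fintype S] [DecidableEq S] {n : ℕ}
    (M : Fin n → Matrix S S R) (a b : S) :
    (List.ofFn M).prod a b = ∑ p : Fin n → S,
      if (Fin.cons a p : Fin (n + 1) → S) (Fin.last n) = b then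
        ∏ k, M k ((Fin.cons a p : Fin (n + 1) → S) k.castSucc) (p k) else 0 := by
  induction n generalizing a with
  | zero => simp [Matrix.one_apply]
  | succ n ih =>
    rw [List.ofFn_succ, List.prod_cons, mul_apply, ← (Fin.consEquiv fun _ => S).sum_comp,
      Fintype.sum_prod_type]
    refine Finset.sum_congr rfl fun c _ => ?_
    rw [ih, Finset.mul_sum]
    refine Finset.sum_congr rfl fun p _ => ?_
    simp only [Fin.consEquiv, Equiv.coe_fn_mk, ← Fin.succ_last, Fin.cons_succ, mul_ite, mul_zero,
      Fin.prod_univ_succ, Fin.castSucc_zero, Fin.cons_zero, ← Fin.succ_castSucc]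

theorem monodromy_eq_prod (q u : R) (m : ℕ) (w : Fin m → R) (y : R) (l r : Fin m → Bool) :
    monodromy q u m w y l r = (List.ofFn fun i => vertexMatrix q u (w i) y (l i) (r i)).prod := by
  induction m with
  | zero => simp [monodromy]
  | succ m ih =>
    rw [monodromy, ih, List.ofFn_succ, List.prod_cons]
    rfl

/-- The weight of a configuration of horizontal edges `p` (to the right of the vertices) and
vertical edges `s` (below the vertices), both indexed by column, then row. -/
def configWeight (q u : R) {n : ℕ} (w y : Fin n → R) (p s : Fin n → Fin n → Bool) : R :=
  if ((Fin.cons (fun _ => false) p : Fin (n + 1) → Fin n → Bool) (Fin.last n) = fun _ => true) ∧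
      ∀ j, (Fin.cons false (s j) : Fin (n + 1) → Bool) (Fin.last n) = true then
    ∏ j, ∏ i, vertexMatrix q u (w i) (y j)
      ((Fin.cons (fun _ => false) p : Fin (n + 1) → Fin n → Bool) j.castSucc i) (p j i)
      ((Fin.cons false (s j) : Fin (n + 1) → Bool) i.castSucc) (s j i)
  else 0

theorem partitionFunction_eq_sum_configWeight (q u : R) {n : ℕ} (w y : Fin n → R) :
    partitionFunction q u w (List.ofFn y) =
      ∑ c : (Fin n → Fin n → Bool) × (Fin n → Fin n → Bool), configWeight q u w y c.1 c.2 := by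
  rw [partitionFunction, transferProd, List.map_ofFn, list_ofFn_prod_apply, Fintype.sum_prod_type]
  refine Finset.sum_congr rfl fun p _ => ?_
  simp only [configWeight, Function.comp_apply, columnTransfer, of_apply, monodromy_eq_prod,
    list_ofFn_prod_apply, ite_and, Finset.prod_univ_sum, Fintype.piFinset_univ]
  split_ifs with h
  · refine Finset.sum_congr rfl fun s _ => ?_
    split_ifs with h1
    · exact Finset.prod_congr rfl fun j _ => if_pos (h1 j)
    · obtain ⟨j, hj⟩ := not_forall.1 h1
      exact Finset.prod_eq_zero (Finset.mem_univ j) (if_neg hj)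
  · simp

/-- The configuration of an alternating sign matrix. -/
def ASM.config {n : ℕ} (A : ASM n) : (Fin n → Fin n → Bool) × (Fin n → Fin n → Bool) :=
  (fun j i => decide (partialSum (fun k => A.1 i k) (j + 1) = 1),
    fun j i => decide (partialSum (fun k => A.1 k j) (i + 1) = 1))

theorem cons_decide_partialSum {n : ℕ} (v : Fin n → ℤ) (k : Fin (n + 1)) :
    (Fin.cons false (fun j : Fin n => decide (partialSum v (j + 1) = 1)) : Fin (n + 1) → Bool) k =
      decide (partialSum v k = 1) := by
  refine Fin.cases ?_ (fun k => ?_) k <;> simp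

theorem cons_decide_partialSum_apply {n : ℕ} (v : Fin n → Fin n → ℤ) (k : Fin (n + 1))
    (i : Fin n) :
    (Fin.cons (fun _ => false) (fun (j : Fin n) i => decide (partialSum (v i) (j + 1) = 1)) :
      Fin (n + 1) → Fin n → Bool) k i = decide (partialSum (v i) k = 1) := by
  refine Fin.cases ?_ (fun k => ?_) k <;> simp

theorem configWeight_config (q u : R) {n : ℕ} (w y : Fin n → R) (A : ASM n) :
    configWeight q u w y A.config.1 A.config.2 =
      ∏ j : Fin n, ∏ i : Fin n, vertexMatrix q u (w i) (y j)
        (decide (partialSum (fun k => A.1 i k) j = 1))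
        (decide (partialSum (fun k => A.1 i k) (j + 1) = 1))
        (decide (partialSum (fun k => A.1 k j) i = 1))
        (decide (partialSum (fun k => A.1 k j) (i + 1) = 1)) := by
  rw [configWeight, if_pos]
  · refine Finset.prod_congr rfl fun j _ => Finset.prod_congr rfl fun i _ => ?_
    simp only [ASM.config]
    rw [cons_decide_partialSum_apply (fun i k => A.1 i k), cons_decide_partialSum]
    rfl
  · constructor
    · ext i
      simp only [ASM.config]
      rw [cons_decide_partialSum_apply (fun i k => A.1 i k), Fin.val_last,
        (A.2.row i).partialSum_self]
      rfl
    · intro j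
      simp only [ASM.config]
      rw [cons_decide_partialSum, Fin.val_last, (A.2.col j).partialSum_self]
      rfl

theorem ASM.config_injective (n : ℕ) : Function.Injective (ASM.config (n := n)) := by
  intro A B h
  have hP : ∀ i : Fin n, ∀ k ≤ n,
      partialSum (fun k => A.1 i k) k = partialSum (fun k => B.1 i k) k := by
    intro i k hk
    obtain _ | k := k
    · simp
    have h1 := congrFun₂ (congrArg Prod.fst h) ⟨k, hk⟩ i
    simp only [ASM.config, decide_eq_decide] at h1
    have h2 := (A.2.row i).partialSum_eq hk
    have h3 := (B.2.row i).partialSum_eq hk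
    omega
  refine Subtype.ext (Matrix.ext fun i j => ?_)
  have h1 := partialSum_succ (fun k => A.1 i k) j
  have h2 := partialSum_succ (fun k => B.1 i k) j
  have h3 := hP i j j.2.le
  have h4 := hP i (j + 1) j.2
  omega

theorem partialSum_sub_toNat {n : ℕ} (e : Fin (n + 1) → Bool) (h0 : e 0 = false) (v : Fin n → ℤ)
    (hv : ∀ k, v k = (e k.succ).toNat - (e k.castSucc).toNat) (k : Fin (n + 1)) :
    partialSum v k = (e k).toNat := by
  induction k using Fin.induction with
  | zero => simp [h0]
  | succ k ih =>
    rw [Fin.val_castSucc] at ih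
    rw [Fin.val_succ, partialSum_succ, ih, hv]
    ring

theorem isAlternating_of_bool {n : ℕ} (e : Fin (n + 1) → Bool) (h0 : e 0 = false)
    (hl : e (Fin.last n) = true) (v : Fin n → ℤ)
    (hv : ∀ k, v k = (e k.succ).toNat - (e k.castSucc).toNat) : IsAlternating v := by
  refine isAlternating_of_partialSum (fun k hk => ?_) ?_
  · have := partialSum_sub_toNat e h0 v hv ⟨k, Nat.lt_succ_of_le hk⟩
    rw [this]
    cases e ⟨k, Nat.lt_succ_of_le hk⟩ <;> simp
  · have := partialSum_sub_toNat e h0 v hv (Fin.last n)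
    rw [hl] at this
    simpa using this

/-- The ice rule: the horizontal and the vertical jump agree, so they define a single matrix entry.
-/
theorem vertexMatrix_ne_zero {q u w y : R} {h h' v v' : Bool}
    (hne : vertexMatrix q u w y h h' v v' ≠ 0) :
    (v'.toNat : ℤ) - v.toNat = h'.toNat - h.toNat := by
  revert hne
  cases h <;> cases h' <;> cases v <;> cases v' <;> simp [vertexMatrix]

theorem exists_config_eq {q u : R} {n : ℕ} {w y : Fin n → R} {p s : Fin n → Fin n → Bool}
    (hne : configWeight q u w y p s ≠ 0) : ∃ A : ASM n, A.config = (p, s) := by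
  rw [configWeight] at hne
  split_ifs at hne with hb
  swap
  · exact absurd rfl hne
  let P : Fin n → Fin (n + 1) → Bool := fun i k =>
    (Fin.cons (fun _ => false) p : Fin (n + 1) → Fin n → Bool) k i
  let S : Fin n → Fin (n + 1) → Bool := fun j => Fin.cons false (s j)
  -- The entries are the horizontal jumps, so the rows alternate by telescoping; by the ice rule
  -- they are also the vertical jumps, which handles the columns.
  let A : Matrix (Fin n) (Fin n) ℤ := Matrix.of fun i j =>
    ((P i j.succ).toNat : ℤ) - (P i j.castSucc).toNat
  have hA : ∀ i j, A i j = ((S j i.succ).toNat : ℤ) - (S j i.castSucc).toNat := fun i j => by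
    refine (vertexMatrix_ne_zero (q := q) (u := u) (w := w i) (y := y j) fun h => hne ?_).symm
    exact Finset.prod_eq_zero (Finset.mem_univ j) (Finset.prod_eq_zero (Finset.mem_univ i) h)
  have hS0 : ∀ j, S j 0 = false := fun j => rfl
  have hP0 : ∀ i, P i 0 = false := fun i => rfl
  refine ⟨⟨A, fun i => isAlternating_of_bool (P i) (hP0 i) (congrFun hb.1 i) _ fun k => rfl,
    fun j => isAlternating_of_bool (S j) (hS0 j) (hb.2 j) _ fun k => hA k j⟩, ?_⟩
  refine Prod.ext (funext₂ fun j i => ?_) (funext₂ fun j i => ?_)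
  · have := partialSum_sub_toNat (P i) (hP0 i) (fun k => A i k) (fun k => rfl) j.succ
    rw [Fin.val_succ] at this
    simp only [ASM.config]
    rw [this]
    change decide (((p j i).toNat : ℤ) = 1) = p j i
    cases p j i <;> rfl
  · have := partialSum_sub_toNat (S j) (hS0 j) (fun k => A k j) (fun k => hA k j) i.succ
    rw [Fin.val_succ] at this
    simp only [ASM.config]
    rw [this]
    change decide (((s j i).toNat : ℤ) = 1) = s j i
    cases s j i <;> rfl

theorem partitionFunction_eq_sum_ASM (q u : R) {n : ℕ} (w y : Fin n → R) :
    partitionFunction q u w (List.ofFn y) = ∑ A : ASM n,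
      ∏ i : Fin n, ∏ j : Fin n, vertexMatrix q u (w i) (y j)
        (decide (partialSum (fun k => A.1 i k) j = 1))
        (decide (partialSum (fun k => A.1 i k) (j + 1) = 1))
        (decide (partialSum (fun k => A.1 k j) i = 1))
        (decide (partialSum (fun k => A.1 k j) (i + 1) = 1)) := by
  rw [partitionFunction_eq_sum_configWeight]
  symm
  refine Finset.sum_of_injOn ASM.config (ASM.config_injective n).injOn (fun _ _ => by simp) ?_ ?_
  · intro c _ hc
    by_contra hne
    obtain ⟨A, hA⟩ := exists_config_eq hne
    exact hc ⟨A, by simp, hA⟩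
  · intro A _
    rw [configWeight_config, Finset.prod_comm]

end ASMConfigurations

/-! ### Evaluation of the weights, and the conclusion. -/

section Evaluation

theorem ASM.first_row_nonneg {n : ℕ} (A : ASM (n + 1)) (j : Fin (n + 1)) : 0 ≤ A.1 0 j := by
  have h := partialSum_succ (fun k => A.1 k j) 0
  have h1 := (A.2.col j).partialSum_eq (k := 1) (by omega)
  simp only [Fin.val_zero, zero_add, partialSum_zero] at h
  omega

/-- The first row is nonnegative, so its partial sums increase from 0 to 1 and differ from 1 exactly
to the left of its 1. -/
theorem ASM.card_filter_first_row {n : ℕ} [NeZero (n + 1)] (A : ASM (n + 1)) :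
    (Finset.univ.filter fun j : Fin (n + 1) =>
      partialSum (fun k => A.1 0 k) (j + 1) ≠ 1).card + 1 = A.f := by
  have hj0 : A.1 0 A.existsUnique_first.choose = 1 := A.existsUnique_first.choose_spec.1
  rw [ASM.f]
  generalize A.existsUnique_first.choose = j₀ at hj0 ⊢
  have hmono : ∀ a b : ℕ, a ≤ b → b ≤ n + 1 →
      partialSum (fun k => A.1 0 k) a ≤ partialSum (fun k => A.1 0 k) b := by
    intro a b hab
    induction b, hab using Nat.le_induction with
    | base => exact fun _ => le_rfl
    | succ b hab ih =>
      intro hb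
      have h1 := partialSum_succ' (fun k => A.1 0 k) (show b < n + 1 by omega)
      have h2 := A.first_row_nonneg ⟨b, by omega⟩
      have := ih (by omega)
      omega
  have h01 := fun (k : ℕ) (hk : k ≤ n + 1) => (A.2.row 0).partialSum_eq hk
  have hs : partialSum (fun k => A.1 0 k) (j₀ + 1) = partialSum (fun k => A.1 0 k) j₀ + 1 := by
    rw [partialSum_succ, hj0]
  have hl := h01 j₀ j₀.2.le
  have hr := h01 (j₀ + 1) j₀.2
  have : (Finset.univ.filter fun j : Fin (n + 1) =>
      partialSum (fun k => A.1 0 k) (j + 1) ≠ 1) = Finset.Iio j₀ := by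
    ext j
    simp only [Finset.mem_filter, Finset.mem_univ, true_and, Finset.mem_Iio, Fin.lt_def]
    have hj := h01 (j + 1) j.2
    constructor
    · intro h
      by_contra! hc
      have := hmono (j₀ + 1) (j + 1) (by omega) j.2
      omega
    · intro h
      have := hmono (j + 1) j₀ (by omega) j₀.2.le
      omega
  rw [this, Fin.card_Iio]

theorem ASM.sum_row {n : ℕ} (A : ASM n) (i : Fin n) : ∑ j, A.1 i j = 1 := by
  have h := (A.2.row i).partialSum_self
  rw [partialSum, Finset.sum_range] at h
  simpa using h

theorem ASM.mu_eq_sum {n : ℕ} (A : ASM n) :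
    A.mu = ∑ i, (Finset.univ.filter fun j => A.1 i j = -1).card := by
  simp only [ASM.mu, Finset.card_filter, Fintype.sum_prod_type]

variable {F : Type*} [Field F]

/-- The four partial sums around an entry of an alternating sign matrix. -/
theorem ASM.partialSum_cases {n : ℕ} (A : ASM n) (i j : Fin n) :
    (partialSum (fun k => A.1 i k) j = 0 ∨ partialSum (fun k => A.1 i k) j = 1) ∧
    (partialSum (fun k => A.1 k j) i = 0 ∨ partialSum (fun k => A.1 k j) i = 1) ∧
    (partialSum (fun k => A.1 i k) (j + 1) = 0 ∨ partialSum (fun k => A.1 i k) (j + 1) = 1) ∧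
    (partialSum (fun k => A.1 k j) (i + 1) = 0 ∨ partialSum (fun k => A.1 k j) (i + 1) = 1) ∧
    partialSum (fun k => A.1 i k) (j + 1) = partialSum (fun k => A.1 i k) j + A.1 i j ∧
    partialSum (fun k => A.1 k j) (i + 1) = partialSum (fun k => A.1 k j) i + A.1 i j :=
  ⟨(A.2.row i).partialSum_eq j.2.le, (A.2.col j).partialSum_eq i.2.le,
    (A.2.row i).partialSum_eq j.2, (A.2.col j).partialSum_eq i.2,
    partialSum_succ _ j, partialSum_succ (fun k => A.1 k j) i⟩

/-- The vertex weights in a homogeneous row. -/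
theorem ASM.vertexMatrix_homogeneous {q : F} (hq0 : q ≠ 0) (hq : 1 + q ≠ 0) {n : ℕ} (A : ASM n)
    (i j : Fin n) :
    vertexMatrix q q⁻¹ 1 1
        (decide (partialSum (fun k => A.1 i k) j = 1))
        (decide (partialSum (fun k => A.1 i k) (j + 1) = 1))
        (decide (partialSum (fun k => A.1 k j) i = 1))
        (decide (partialSum (fun k => A.1 k j) (i + 1) = 1)) =
      (1 - q) * (1 + q) ^ A.1 i j * if A.1 i j = -1 then 2 + q + q⁻¹ else 1 := by
  obtain ⟨h1, h2, h3, h4, h5, h6⟩ := A.partialSum_cases i j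
  rw [h5] at h3 ⊢
  rw [h6] at h4 ⊢
  generalize A.1 i j = a at *
  rcases h1 with h1 | h1 <;> rcases h2 with h2 | h2 <;> rw [h1] at h3 ⊢ <;> rw [h2] at h4 ⊢ <;>
    rcases h3 with h3 | h3
  · obtain rfl : a = 0 := by omega
    simp [vertexMatrix]
  · obtain rfl : a = 1 := by omega
    simp [vertexMatrix]
    ring
  · obtain rfl : a = 0 := by omega
    simp [vertexMatrix]
  · omega
  · omega
  · obtain rfl : a = 0 := by omega
    simp [vertexMatrix]
  · obtain rfl : a = -1 := by omega
    simp [vertexMatrix]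
    field_simp
    ring
  · obtain rfl : a = 0 := by omega
    simp [vertexMatrix]

/-- The vertex weights in the first row. -/
theorem ASM.vertexMatrix_first_row {q ρ : F} (hρ : 1 + ρ * q ≠ 0) {n : ℕ} (A : ASM (n + 1))
    (j : Fin (n + 1)) :
    vertexMatrix q q⁻¹ ((ρ + q) / (1 + ρ * q)) 1
        (decide (partialSum (fun k => A.1 0 k) j = 1))
        (decide (partialSum (fun k => A.1 0 k) (j + 1) = 1))
        (decide (partialSum (fun k => A.1 k j) (0 : Fin (n + 1)) = 1))
        (decide (partialSum (fun k => A.1 k j) ((0 : Fin (n + 1)) + 1) = 1)) =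
      (1 - q ^ 2) / (1 + ρ * q) * (1 + ρ * q) ^ A.1 0 j *
        if partialSum (fun k => A.1 0 k) (j + 1) ≠ 1 then ρ else 1 := by
  obtain ⟨h1, h2, h3, h4, h5, h6⟩ := A.partialSum_cases 0 j
  have h0 := A.first_row_nonneg j
  have hρ' : 1 + q * ρ ≠ 0 := by rwa [mul_comm q]
  rw [h5] at h3 ⊢
  rw [h6] at h4 ⊢
  rw [Fin.val_zero, partialSum_zero] at *
  generalize A.1 0 j = a at *
  rcases h1 with h1 | h1 <;> rw [h1] at h3 ⊢ <;> rcases h3 with h3 | h3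
  · obtain rfl : a = 0 := by omega
    simp [vertexMatrix]
    field_simp
    ring
  · obtain rfl : a = 1 := by omega
    simp [vertexMatrix]
    field_simp
  · omega
  · obtain rfl : a = 0 := by omega
    simp [vertexMatrix]
    field_simp
    ring

theorem prod_zpow_entry {n : ℕ} (A : ASM n) (i : Fin n) {c : F} (hc : c ≠ 0) :
    ∏ j, c ^ A.1 i j = c := by
  have h : ∀ s : Finset (Fin n), ∏ j ∈ s, c ^ A.1 i j = c ^ ∑ j ∈ s, A.1 i j := fun s => by
    classical
    induction s using Finset.induction_on with
    | empty => simp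
    | insert a s ha ih => rw [Finset.prod_insert ha, Finset.sum_insert ha, zpow_add₀ hc, ih]
  rw [h, A.sum_row, zpow_one]

/-- The first-row weights supply only ρ^(f - 1), whence the extra factor ρ on the left. -/
theorem partitionFunction_eq_sum_weight {q ρ : F} (hq0 : q ≠ 0) (hq : 1 + q ≠ 0)
    (hρ : 1 + ρ * q ≠ 0) (n : ℕ) [NeZero (n + 1)] :
    ρ * partitionFunction q q⁻¹ (Fin.cons ((ρ + q) / (1 + ρ * q)) fun _ => 1 : Fin (n + 1) → F)
        (List.replicate (n + 1) 1) =
      ((1 - q ^ 2) / (1 + ρ * q)) ^ (n + 1) * (1 + ρ * q) * ((1 - q) ^ (n + 1) * (1 + q)) ^ n *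
        ∑ A : ASM (n + 1), (2 + q + q⁻¹) ^ A.mu * ρ ^ A.f := by
  rw [← List.ofFn_const, partitionFunction_eq_sum_ASM, Finset.mul_sum, Finset.mul_sum]
  refine Finset.sum_congr rfl fun A _ => ?_
  have h0 : (Finset.univ.filter fun j => A.1 0 j = -1).card = 0 := by
    rw [Finset.card_eq_zero, Finset.filter_eq_empty_iff]
    intro j _ h
    have := A.first_row_nonneg j
    omega
  rw [Fin.prod_univ_succ]
  simp only [Fin.cons_zero, Fin.cons_succ, A.vertexMatrix_first_row hρ,
    A.vertexMatrix_homogeneous hq0 hq, Finset.prod_mul_distrib, prod_zpow_entry A _ hq,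
    prod_zpow_entry A _ hρ, Finset.prod_const, Finset.card_univ, Fintype.card_fin,
    Finset.prod_ite, one_pow, mul_one]
  rw [A.mu_eq_sum, Fin.sum_univ_succ, h0, zero_add, Finset.prod_pow_eq_pow_sum,
    ← A.card_filter_first_row, pow_succ ρ, mul_pow ((1 - q) ^ (n + 1))]
  ring

end Evaluation

theorem corollary5p1 {F : Type*} [Field F] [CharZero F] (n : ℕ) [NeZero n] (q ρ : F)
    (hq0 : q ≠ 0) (hq1 : q ≠ 1) (hqm1 : q ≠ -1) (hρ : 1 + ρ * q ≠ 0) :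
    asmGenFun n (2 + q + q⁻¹) ρ 1 = ∑ A : ASM n, (2 + q + q⁻¹) ^ A.mu * ρ ^ A.f ∧
    ∑ A : ASM n, (2 + q + q⁻¹) ^ A.mu * ρ ^ A.f =
      ρ * (kMatrix n q ρ).det /
        ((1 + ρ * q) * (1 + q) ^ (n - 1) * (2 - q - q⁻¹) ^ (n * (n - 1) / 2)) := by
  refine ⟨by simp [asmGenFun], ?_⟩
  obtain ⟨n, rfl⟩ := Nat.exists_eq_succ_of_ne_zero (NeZero.ne n)
  have hp : 1 + q ≠ 0 := fun h => hqm1 (by linear_combination h)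
  have hm : 1 - q ≠ 0 := fun h => hq1 (by linear_combination -h)
  have hsq : q ^ 2 ≠ 1 := fun h => mul_ne_zero hm hp (by linear_combination -h)
  have hZ := partitionFunction_eq_sum_weight hq0 hp hρ n
  rw [partitionFunction_eq_det_kMatrix hq0 hsq hρ] at hZ
  -- This matches the powers of 1 - q from the homogeneous rows and the power of -q from Kostov's
  -- determinant with the stated denominator.
  have hz : 2 - q - q⁻¹ = (1 - q) ^ 2 / -q := by
    field_simp
    ring
  have he : (n + 1) * (n + 1 - 1) / 2 = (n + 1).choose 2 := (Nat.choose_two_right _).symm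
  have he2 : 2 * (n + 1).choose 2 = (n + 1) * n := by
    rw [← he]
    exact Nat.mul_div_cancel' (Nat.even_mul_pred_self (n + 1)).two_dvd
  have hd : (1 + ρ * q) * (1 + q) ^ (n + 1 - 1) * (2 - q - q⁻¹) ^ ((n + 1) * (n + 1 - 1) / 2) =
      (1 + ρ * q) * (1 + q) ^ n * (1 - q) ^ ((n + 1) * n) / (-q) ^ (n + 1).choose 2 := by
    rw [he, hz, div_pow, ← pow_mul, he2, Nat.add_sub_cancel]
    ring
  have hqq : q * (q⁻¹ - q) = 1 - q ^ 2 := by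
    rw [mul_sub, mul_inv_cancel₀ hq0, pow_two]
  have hnq : (-q) ^ (n + 1).choose 2 ≠ 0 := pow_ne_zero _ (neg_ne_zero.2 hq0)
  have h1q : (1 - q ^ 2) ^ (n + 1) ≠ 0 := pow_ne_zero _ (sub_ne_zero.2 hsq.symm)
  have hr : (1 + ρ * q) ^ (n + 1) ≠ 0 := pow_ne_zero _ hρ
  rw [hqq, div_pow, mul_pow ((1 - q) ^ (n + 1)), ← pow_mul] at hZ
  change ∑ A : ASM (n + 1), _ = ρ * (kMatrix (n + 1) q ρ).det /
    ((1 + ρ * q) * (1 + q) ^ (n + 1 - 1) * (2 - q - q⁻¹) ^ ((n + 1) * (n + 1 - 1) / 2))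
  rw [hd, eq_div_iff (div_ne_zero (mul_ne_zero (mul_ne_zero hρ (pow_ne_zero _ hp))
    (pow_ne_zero _ hm)) hnq)]
  have hc : (1 - q ^ 2) ^ (n + 1) / (1 + ρ * q) ^ (n + 1) ≠ 0 := div_ne_zero h1q hr
  refine mul_left_cancel₀ (mul_ne_zero hc hnq) ?_
  rw [div_eq_mul_inv _ ((-q) ^ (n + 1).choose 2)]
  linear_combination (-1 : F) * hZ + ((1 - q ^ 2) ^ (n + 1) / (1 + ρ * q) ^ (n + 1) *
    (∑ A : ASM (n + 1), (2 + q + q⁻¹) ^ A.mu * ρ ^ A.f) * ((1 + ρ * q) * (1 + q) ^ n *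
      (1 - q) ^ ((n + 1) * n))) * (mul_inv_cancel₀ hnq)
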